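/- Let $Q(x,y)=\dfrac{4(y^2-x^2+3)}{(x^2+y^2+3)^2}$ be the lump solution of the KP-I equation. Let $\phi:\mathbb{R}^2\to\mathbb{R}$ be a $C^\infty$ function that solves the KP-I equation linearized at the lump, $$\partial_x^2\left(\partial_x^2\phi-\phi+6Q\phi\right)-\partial_y^2\phi=0\quad\text{on }\mathbb{R}^2,$$ and assume that $\phi(x,y)\to 0$ as $x^2+y^2\to+\infty$. Then there are real constants $c_1,c_2$ such that $\phi=c_1\,\partial_xQ+c_2\,\partial_yQ$ on $\mathbb{R}^2$. -/

import Mathlib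

open Filter Topology
open scoped ContDiff

/-- The partial derivative in the first variable of a function on the plane. -/
noncomputable def partialX (f : ℝ × ℝ → ℝ) (p : ℝ × ℝ) : ℝ :=
  deriv (fun s : ℝ => f (s, p.2)) p.1

/-- The partial derivative in the second variable of a function on the plane. -/
noncomputable def partialY (f : ℝ × ℝ → ℝ) (p : ℝ × ℝ) : ℝ :=
  deriv (fun s : ℝ => f (p.1, s)) p.2

/-- The lump solution of the KP-I equation (speed one, at time zero). -/
noncomputable def lump (p : ℝ × ℝ) : ℝ :=
  4 * (p.2 ^ 2 - p.1 ^ 2 + 3) / (p.1 ^ 2 + p.2 ^ 2 + 3) ^ 2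

/-- The operator `∂ₓ²(∂ₓ²φ - φ + 6Qφ) - ∂ᵧ²φ`, the linearization at the lump `Q` of the equation
for travelling waves of speed one of the KP-I equation. -/
noncomputable def linearizedKPI (φ : ℝ × ℝ → ℝ) (p : ℝ × ℝ) : ℝ :=
  partialX (partialX (fun q => partialX (partialX φ) q - φ q + 6 * lump q * φ q)) p
    - partialY (partialY φ) p

/-! Write L for the linearized operator at the lump and L₀ = ∂ₓ⁴ - ∂ₓ² - ∂ᵧ² for the linearization
at zero. The explicit fourth-order operators P = `intertwiner` and P' = `intertwiner'` satisfy Lᵗ P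
= P' L₀ (`linOpAdj_intertwiner`). Since L₀ is its own transpose, this gives L₀ P'ᵗ = Pᵗ L, so a
solution u of L u = 0 produces w = P'ᵗ u, which is `annX u`, with L₀ w = 0.

The symbol of L₀ vanishes only at frequency zero, so w can only live there. On the other hand w is a
sum of derivatives of bounded functions times u, and u decays, so w tends to zero under averaging
over larger and larger scales. Hence w = 0 (`annX_eq_zero`). Nothing is known about the decay of the
derivatives of u, so this argument is carried out with all operators moved onto Schwartz test
functions.

Subtracting 4 L u from `annX u` cancels ∂ₓ⁴u and leaves a second equation, `annY u = 0`. The two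
equations express ∂ₓ⁴u and ∂ᵧ²u through lower derivatives, so a common solution is determined by the
eight values ∂ₓⁱ∂ᵧʲu(0) with i ≤ 3, j ≤ 1 (`eq_zero_of_jet_eq_zero`). Eight explicit solutions
realize all such values (`exists_combination`): the two derivatives of the lump, one with limit 1
along the lines considered, one growing like xy, and four carrying the exponentials e^{±px±qy} with
p² = 3/4, q² = -3/16. Asymptotics along lines exclude all but the derivatives of the lump
(`eq_combination_of_tendsto_zero`). -/

/-! ### The differential algebra of smooth functions on the plane. -/

/-- The algebra of smooth complex-valued functions on the plane, identified with `ℂ`. -/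
def smoothFunctions : Subalgebra ℂ (ℂ → ℂ) where
  carrier := {f | ContDiff ℝ ∞ f}
  mul_mem' {f g} (hf : ContDiff ℝ ∞ f) (hg : ContDiff ℝ ∞ g) := show ContDiff ℝ ∞ _ from hf.mul hg
  add_mem' {f g} (hf : ContDiff ℝ ∞ f) (hg : ContDiff ℝ ∞ g) := show ContDiff ℝ ∞ _ from hf.add hg
  algebraMap_mem' c := show ContDiff ℝ ∞ fun _ : ℂ => c from contDiff_const

namespace smoothFunctions

theorem contDiff_coe (f : smoothFunctions) : ContDiff ℝ ∞ (f : ℂ → ℂ) := f.2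

theorem differentiable_coe (f : smoothFunctions) : Differentiable ℝ (f : ℂ → ℂ) :=
  (contDiff_coe f).differentiable (by simp)

theorem continuous_coe (f : smoothFunctions) : Continuous (f : ℂ → ℂ) := (contDiff_coe f).continuous

/-- The directional derivative as a derivation of the algebra of smooth functions. -/
noncomputable def dir (v : ℂ) : Derivation ℂ smoothFunctions smoothFunctions where
  toFun f := ⟨fun z => fderiv ℝ (f : ℂ → ℂ) z v, show ContDiff ℝ ∞ _ from ((contDiff_coe f).fderiv_right (m := ∞) (by simp)).clm_apply contDiff_const⟩
  map_add' f g := by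
    ext z
    have := fderiv_add (differentiable_coe f z) (differentiable_coe g z)
    simp [this]
  map_smul' c f := by
    ext z
    have := fderiv_const_smul (differentiable_coe f z) c
    simp [this]
  map_one_eq_zero' := by
    ext z
    simp [Pi.one_def]
  leibniz' f g := by
    ext z
    have := fderiv_mul (differentiable_coe f z) (differentiable_coe g z)
    simp [this]

theorem dir_apply (v : ℂ) (f : smoothFunctions) (z : ℂ) : (dir v f : ℂ → ℂ) z = fderiv ℝ f z v :=
  rfl

/-- The derivative in the real direction. -/
noncomputable abbrev dx : Derivation ℂ smoothFunctions smoothFunctions := dir 1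

/-- The derivative in the imaginary direction. -/
noncomputable abbrev dy : Derivation ℂ smoothFunctions smoothFunctions := dir Complex.I

theorem dir_comm (v w : ℂ) (f : smoothFunctions) : dir v (dir w f) = dir w (dir v f) := by
  ext z
  have h : ∀ a b : ℂ, (dir a (dir b f) : ℂ → ℂ) z = fderiv ℝ (fderiv ℝ f) z a b := by
    intro a b
    have hd : DifferentiableAt ℝ (fderiv ℝ (f : ℂ → ℂ)) z :=
      ((contDiff_coe f).fderiv_right (m := 1) (by norm_cast)).differentiable (by simp) z
    have : (dir b f : ℂ → ℂ) = fun z => fderiv ℝ f z b := rfl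
    rw [dir_apply, this, fderiv_clm_apply hd (by fun_prop)]
    simp
  rw [h, h]
  exact ((contDiff_coe f).contDiffAt.isSymmSndFDerivAt (by simp; norm_cast)) v w

/-- As a rewriting rule this brings mixed derivatives to a normal form, with the x-derivatives
outermost. -/
theorem dy_dx (f : smoothFunctions) : dy (dx f) = dx (dy f) := dir_comm _ _ f

/-- The first coordinate. -/
def X : smoothFunctions := ⟨fun z => (z.re : ℂ), by
  change ContDiff ℝ ∞ (Complex.ofRealCLM.comp Complex.reCLM)
  exact ContinuousLinearMap.contDiff _⟩

/-- The second coordinate. -/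
def Y : smoothFunctions := ⟨fun z => (z.im : ℂ), by
  change ContDiff ℝ ∞ (Complex.ofRealCLM.comp Complex.imCLM)
  exact ContinuousLinearMap.contDiff _⟩

theorem den_ne_zero (z : ℂ) : (z.re : ℂ) ^ 2 + (z.im : ℂ) ^ 2 + 3 ≠ 0 := by
  have : (0 : ℝ) < z.re ^ 2 + z.im ^ 2 + 3 := by positivity
  exact_mod_cast this.ne'

/-- The inverse of the tau function `x² + y² + 3` of the lump. -/
noncomputable def T : smoothFunctions := ⟨fun z => ((z.re : ℂ) ^ 2 + (z.im : ℂ) ^ 2 + 3)⁻¹, by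
  refine ContDiff.inv (n := ∞) (𝕜 := ℝ) ?_ den_ne_zero
  exact (contDiff_coe (X ^ 2 + Y ^ 2)).add contDiff_const⟩

/-- The exponential `exp (p x + q y)`. -/
noncomputable def expo (p q : ℂ) : smoothFunctions :=
  ⟨fun z => Complex.exp (p * z.re + q * z.im), by
    exact (contDiff_coe (p • X + q • Y)).cexp⟩

theorem X_apply (z : ℂ) : (X : ℂ → ℂ) z = z.re := rfl
theorem Y_apply (z : ℂ) : (Y : ℂ → ℂ) z = z.im := rfl
theorem T_apply (z : ℂ) : (T : ℂ → ℂ) z = ((z.re : ℂ) ^ 2 + (z.im : ℂ) ^ 2 + 3)⁻¹ := rfl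
theorem expo_apply (p q z : ℂ) : (expo p q : ℂ → ℂ) z = Complex.exp (p * z.re + q * z.im) := rfl

theorem dir_X (v : ℂ) : dir v X = algebraMap ℂ _ (v.re : ℂ) := by
  ext z
  have : HasFDerivAt (X : ℂ → ℂ) (Complex.ofRealCLM.comp Complex.reCLM) z :=
    (Complex.ofRealCLM.comp Complex.reCLM).hasFDerivAt
  rw [dir_apply, this.fderiv]
  rfl

theorem dir_Y (v : ℂ) : dir v Y = algebraMap ℂ _ (v.im : ℂ) := by
  ext z
  have : HasFDerivAt (Y : ℂ → ℂ) (Complex.ofRealCLM.comp Complex.imCLM) z :=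
    (Complex.ofRealCLM.comp Complex.imCLM).hasFDerivAt
  rw [dir_apply, this.fderiv]
  rfl

@[simp] theorem dx_X : dx X = 1 := by simp [dir_X]
@[simp] theorem dy_X : dy X = 0 := by simp [dir_X]
@[simp] theorem dx_Y : dx Y = 0 := by simp [dir_Y]
@[simp] theorem dy_Y : dy Y = 1 := by simp [dir_Y]

/-- The only relation between `X`, `Y` and `T`. Once derivatives are expanded, the identities
between operators and rational functions are ring identities modulo this one. -/
theorem T_mul : T * (X ^ 2 + Y ^ 2 + 3) = 1 := by
  ext z
  have := den_ne_zero z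
  change ((z.re : ℂ) ^ 2 + (z.im : ℂ) ^ 2 + 3)⁻¹ * ((z.re : ℂ) ^ 2 + (z.im : ℂ) ^ 2 + 3) = 1
  field_simp

/-- Differentiate `T_mul` and multiply by `T`; no analysis of the inverse function is needed. -/
theorem derivation_T (D : Derivation ℂ smoothFunctions smoothFunctions) :
    D T = -T ^ 2 * (2 * X * D X + 2 * Y * D Y) := by
  have h := congrArg D T_mul
  simp only [Derivation.leibniz, Derivation.leibniz_pow, map_add, Derivation.map_one_eq_zero,
    smul_eq_mul, nsmul_eq_mul] at h
  have h3 : D (3 : smoothFunctions) = 0 := by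
    exact_mod_cast D.map_natCast 3
  rw [h3] at h
  have := T_mul
  linear_combination T * h - D T * T_mul

@[simp] theorem dx_T : dx T = -2 * X * T ^ 2 := by
  rw [derivation_T]; simp; ring
@[simp] theorem dy_T : dy T = -2 * Y * T ^ 2 := by
  rw [derivation_T]; simp; ring

theorem derivation_expo (v p q : ℂ) : dir v (expo p q) = (p * v.re + q * v.im) • expo p q := by
  ext z
  have h := differentiable_coe (p • X + q • Y) z
  have : (expo p q : ℂ → ℂ) = fun z =>
      Complex.exp (((p • X + q • Y : smoothFunctions) : ℂ → ℂ) z) := rfl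
  rw [dir_apply, this, h.hasFDerivAt.cexp.fderiv]
  have h2 : fderiv ℝ ((p • X + q • Y : smoothFunctions) : ℂ → ℂ) z v
    = p * v.re + q * v.im := by
    rw [← dir_apply, map_add, Derivation.map_smul, Derivation.map_smul, dir_X, dir_Y]
    rfl
  rw [smul_apply, h2]
  exact mul_comm _ _

@[simp] theorem dx_expo (p q : ℂ) : dx (expo p q) = algebraMap ℂ _ p * expo p q := by
  simp [derivation_expo, Algebra.smul_def]
@[simp] theorem dy_expo (p q : ℂ) : dy (expo p q) = algebraMap ℂ _ q * expo p q := by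
  simp [derivation_expo, Algebra.smul_def]

set_option linter.unusedSimpArgs false

/-! ### The linearized operator, the intertwining relation and the two annihilating operators. -/

/-- The lump as an element of the algebra of smooth functions. -/
noncomputable def lumpFun : smoothFunctions := 4 * (Y ^ 2 - X ^ 2 + 3) * T ^ 2

/-- The constant-coefficient operator `∂ₓ⁴ - ∂ₓ² - ∂ᵧ²`. -/
noncomputable def freeOp (f : smoothFunctions) : smoothFunctions :=
  dx (dx (dx (dx f))) - dx (dx f) - dy (dy f)

/-- The linearized operator at the lump. -/
noncomputable def linOp (f : smoothFunctions) : smoothFunctions :=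
  dx (dx (dx (dx f) - f + 6 * lumpFun * f)) - dy (dy f)

/-- The formal adjoint of the linearized operator. -/
noncomputable def linOpAdj (f : smoothFunctions) : smoothFunctions :=
  freeOp f + 6 * lumpFun * dx (dx f)

/-- The operator intertwining the free operator with the adjoint of the linearized operator. -/
noncomputable def intertwiner (f : smoothFunctions) : smoothFunctions :=
  4 * dx (dx (dx (dx f))) - 3 * dx (dx f) + 36 * (T * dx (dx f)) + 12 * (X * T * dx f)
    - 12 * (Y * T * dy f) - 24 * (X * T * dx (dx (dx f)))

/-- The zeroth order correction of the intertwining operator. -/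
noncomputable def correction : smoothFunctions := 24 * T - 48 * X ^ 2 * T ^ 2 - 144 * T ^ 2

/-- The second operator of the intertwining relation. -/
noncomputable def intertwiner' (f : smoothFunctions) : smoothFunctions :=
  intertwiner f + correction * f

@[simp] theorem derivation_ofNat (D : Derivation ℂ smoothFunctions smoothFunctions) (n : ℕ)
    [n.AtLeastTwo] : D (ofNat(n) : smoothFunctions) = 0 := D.map_natCast n

/-- The algebraic heart of the proof. In normal form the derivatives of `f` are independent atoms,
and their coefficients agree modulo `T_mul`. -/
theorem linOpAdj_intertwiner (f : smoothFunctions) :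
    linOpAdj (intertwiner f) = intertwiner' (freeOp f) := by
  simp only [linOpAdj, intertwiner', intertwiner, freeOp, lumpFun, correction, map_add, map_sub, map_neg,
    Derivation.leibniz, Derivation.leibniz_pow, smul_eq_mul, nsmul_eq_mul, dx_X, dx_Y, dx_T, dy_X,
    dy_Y, dy_T, dy_dx, derivation_ofNat, map_zero, Nat.cast_ofNat, mul_zero, zero_mul, add_zero,
    zero_add, sub_zero, neg_zero, mul_one, Nat.add_one_sub_one, pow_one]
  grind [T_mul]

/-- The differential operator that sends solutions of the linearized equation to solutions of the
free equation. -/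
noncomputable def annX (f : smoothFunctions) : smoothFunctions :=
  4 * dx (dx (dx (dx f))) + 24 * X * T * dx (dx (dx f))
    + (-3 + 108 * T - 144 * X ^ 2 * T ^ 2) * dx (dx f)
    + (-12 * X * T - 576 * X * T ^ 2 + 576 * X ^ 3 * T ^ 3) * dx f + 12 * Y * T * dy f
    + (-288 * T ^ 2 + 1440 * X ^ 2 * T ^ 3 - 1152 * X ^ 4 * T ^ 4) * f

/-- The difference of `annX` and four times the linearized operator. -/
noncomputable def annY (f : smoothFunctions) : smoothFunctions :=
  4 * dy (dy f) + 24 * X * T * dx (dx (dx f))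
    + (1 + 12 * T + 48 * X ^ 2 * T ^ 2) * dx (dx f)
    + (-12 * X * T + 576 * X * T ^ 2 - 960 * X ^ 3 * T ^ 3) * dx f + 12 * Y * T * dy f
    + (288 * T ^ 2 - 3168 * X ^ 2 * T ^ 3 + 3456 * X ^ 4 * T ^ 4) * f

/-- The left side is the formal transpose of `intertwiner'`: coefficients move inside the
derivatives and odd-order terms change sign. -/
theorem annX_eq_adjoint (f : smoothFunctions) :
    4 * dx (dx (dx (dx f))) - 3 * dx (dx f) + 36 * dx (dx (T * f)) - 12 * dx (X * T * f)
      + 12 * dy (Y * T * f) + 24 * dx (dx (dx (X * T * f))) + correction * f = annX f := by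
  simp only [annX, correction, map_add, map_neg, neg_mul, mul_neg,
    Derivation.leibniz, Derivation.leibniz_pow, smul_eq_mul, nsmul_eq_mul, dx_X, dx_Y, dx_T, dy_X,
    dy_Y, dy_T, dy_dx, derivation_ofNat, map_zero, Nat.cast_ofNat, mul_zero, zero_mul, add_zero,
    zero_add, sub_zero, neg_zero, mul_one, Nat.add_one_sub_one, pow_one]
  grind [T_mul]

/-- The terms 4∂ₓ⁴ cancel and -4 `linOp` contributes 4∂ᵧ², so a solution killed by `annX` satisfies
a second equation, of order two in y. -/
theorem annX_sub_linOp (f : smoothFunctions) : annX f - 4 * linOp f = annY f := by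
  simp only [annX, annY, linOp, lumpFun, map_add, map_sub, map_neg,
    Derivation.leibniz, Derivation.leibniz_pow, smul_eq_mul, nsmul_eq_mul, dx_X, dx_Y, dx_T, dy_X,
    dy_Y, dy_T, dy_dx, derivation_ofNat, map_zero, Nat.cast_ofNat, mul_zero, zero_mul, add_zero,
    zero_add, sub_zero, neg_zero, mul_one, Nat.add_one_sub_one, pow_one]
  grind [T_mul]

/-! ### Explicit common solutions of the two equations. -/

/-- The even solution of the linearized equation that does not decay. -/
noncomputable def evenSol : smoothFunctions :=
  1 + 24 * T - 120 * X ^ 2 * T ^ 2 - 144 * T ^ 2 + 96 * X ^ 4 * T ^ 3 + 576 * X ^ 2 * T ^ 3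

/-- The odd-odd rational solution of the linearized equation, which grows quadratically. -/
noncomputable def oddSol : smoothFunctions :=
  X * Y * (1 - 56 * X ^ 2 * T ^ 2 + 32 * X ^ 4 * T ^ 3 - 192 * X ^ 2 * T ^ 3 + 24 * T + 144 * T ^ 2)

/-- The exponential solutions of the linearized equation. -/
noncomputable def expSol (p q : ℂ) : smoothFunctions :=
  dx (dx (expo p q * ((27 - 6 * algebraMap ℂ _ p * X - 12 * algebraMap ℂ _ q * Y) * T)))

theorem annX_lump_x : annX (dx lumpFun) = 0 := by
  simp only [annX, lumpFun, map_add, map_sub, map_neg,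
    Derivation.leibniz, Derivation.leibniz_pow, smul_eq_mul, nsmul_eq_mul, dx_X, dx_Y, dx_T, dy_X,
    dy_Y, dy_T, dy_dx, derivation_ofNat, map_zero, Nat.cast_ofNat, mul_zero, zero_mul, add_zero,
    zero_add, sub_zero, neg_zero, mul_one, Nat.add_one_sub_one, pow_one]
  grind [T_mul]

theorem annY_lump_x : annY (dx lumpFun) = 0 := by
  simp only [annY, lumpFun, map_add, map_sub, map_neg,
    Derivation.leibniz, Derivation.leibniz_pow, smul_eq_mul, nsmul_eq_mul, dx_X, dx_Y, dx_T, dy_X,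
    dy_Y, dy_T, dy_dx, derivation_ofNat, map_zero, Nat.cast_ofNat, mul_zero, zero_mul, add_zero,
    zero_add, sub_zero, neg_zero, mul_one, Nat.add_one_sub_one, pow_one]
  grind [T_mul]

theorem annX_lump_y : annX (dy lumpFun) = 0 := by
  simp only [annX, lumpFun, map_add, map_sub, map_neg,
    Derivation.leibniz, Derivation.leibniz_pow, smul_eq_mul, nsmul_eq_mul, dx_X, dx_Y, dx_T, dy_X,
    dy_Y, dy_T, dy_dx, derivation_ofNat, map_zero, Nat.cast_ofNat, mul_zero, zero_mul, add_zero,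
    zero_add, sub_zero, neg_zero, mul_one, Nat.add_one_sub_one, pow_one]
  grind [T_mul]

theorem annY_lump_y : annY (dy lumpFun) = 0 := by
  simp only [annY, lumpFun, map_add, map_sub, map_neg,
    Derivation.leibniz, Derivation.leibniz_pow, smul_eq_mul, nsmul_eq_mul, dx_X, dx_Y, dx_T, dy_X,
    dy_Y, dy_T, dy_dx, derivation_ofNat, map_zero, Nat.cast_ofNat, mul_zero, zero_mul, add_zero,
    zero_add, sub_zero, neg_zero, mul_one, Nat.add_one_sub_one, pow_one]
  grind [T_mul]

theorem annX_evenSol : annX evenSol = 0 := by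
  simp only [annX, evenSol, map_add, map_sub, map_neg, Derivation.map_one_eq_zero,
    Derivation.leibniz, Derivation.leibniz_pow, smul_eq_mul, nsmul_eq_mul, dx_X, dx_Y, dx_T, dy_X,
    dy_Y, dy_T, dy_dx, derivation_ofNat, map_zero, Nat.cast_ofNat, mul_zero, zero_mul, add_zero,
    zero_add, sub_zero, neg_zero, mul_one, Nat.add_one_sub_one, pow_one]
  grind [T_mul]

theorem annY_evenSol : annY evenSol = 0 := by
  simp only [annY, evenSol, map_add, map_sub, map_neg, Derivation.map_one_eq_zero,
    Derivation.leibniz, Derivation.leibniz_pow, smul_eq_mul, nsmul_eq_mul, dx_X, dx_Y, dx_T, dy_X,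
    dy_Y, dy_T, dy_dx, derivation_ofNat, map_zero, Nat.cast_ofNat, mul_zero, zero_mul, add_zero,
    zero_add, sub_zero, neg_zero, mul_one, Nat.add_one_sub_one, pow_one]
  grind [T_mul]

theorem annX_oddSol : annX oddSol = 0 := by
  simp only [annX, oddSol, map_add, map_sub, map_neg, Derivation.map_one_eq_zero,
    Derivation.leibniz, Derivation.leibniz_pow, smul_eq_mul, nsmul_eq_mul, dx_X, dx_Y, dx_T, dy_X,
    dy_Y, dy_T, dy_dx, derivation_ofNat, map_zero, Nat.cast_ofNat, mul_zero, zero_mul, add_zero,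
    zero_add, sub_zero, neg_zero, mul_one, Nat.add_one_sub_one, pow_one]
  grind [T_mul]

theorem annY_oddSol : annY oddSol = 0 := by
  simp only [annY, oddSol, map_add, map_sub, map_neg, Derivation.map_one_eq_zero,
    Derivation.leibniz, Derivation.leibniz_pow, smul_eq_mul, nsmul_eq_mul, dx_X, dx_Y, dx_T, dy_X,
    dy_Y, dy_T, dy_dx, derivation_ofNat, map_zero, Nat.cast_ofNat, mul_zero, zero_mul, add_zero,
    zero_add, sub_zero, neg_zero, mul_one, Nat.add_one_sub_one, pow_one]
  grind [T_mul]

theorem dx_expo_mul (p q : ℂ) (h : smoothFunctions) :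
    dx (expo p q * h) = expo p q * (dx h + algebraMap ℂ _ p * h) := by
  rw [Derivation.leibniz, dx_expo, smul_eq_mul, smul_eq_mul]
  ring

theorem dy_expo_mul (p q : ℂ) (h : smoothFunctions) :
    dy (expo p q * h) = expo p q * (dy h + algebraMap ℂ _ q * h) := by
  rw [Derivation.leibniz, dy_expo, smul_eq_mul, smul_eq_mul]
  ring

theorem derivation_ofNat_mul (D : Derivation ℂ smoothFunctions smoothFunctions) (n : ℕ)
    [n.AtLeastTwo] (f : smoothFunctions) : D (ofNat(n) * f) = ofNat(n) * D f := by
  simp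

theorem eq_zero_of_ofNat_mul {n : ℕ} [n.AtLeastTwo] {f : smoothFunctions}
    (h : ofNat(n) * f = 0) : f = 0 := by
  have h1 : (ofNat(n) : ℂ) • f = 0 := by
    rw [Algebra.smul_def, map_ofNat, h]
  exact (smul_eq_zero.1 h1).resolve_left (NeZero.ne _)

/-! ### The exponential solutions. -/

section Exponential

variable {p q : ℂ}

/-- The exponents come from the limit operators at infinity: with `T` replaced by 0, `annX` becomes
4∂ₓ⁴ - 3∂ₓ² and `annY` becomes 4∂ᵧ² + ∂ₓ², so a nonconstant exponential has 4p² = 3 and 4q² = -p².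
-/
theorem algebraMap_relation (hp : 4 * p ^ 2 = 3) :
    4 * algebraMap ℂ smoothFunctions p ^ 2 = 3 := by
  simpa only [map_mul, map_pow, map_ofNat] using congrArg (algebraMap ℂ smoothFunctions) hp

theorem algebraMap_relation' (hq : 16 * q ^ 2 = -3) :
    16 * algebraMap ℂ smoothFunctions q ^ 2 = -3 := by
  simpa only [map_mul, map_pow, map_neg, map_ofNat] using congrArg (algebraMap ℂ smoothFunctions) hq

/-- The coefficient of the exponential in a derivative of `4 * expSol p q`. -/
noncomputable def expCoeff00 (p q : ℂ) : smoothFunctions :=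
  45 * T - 216 * T ^ 2 - 36 * Y * T * algebraMap ℂ _ q + 96 * Y * T ^ 2 * algebraMap ℂ _ q -
    18 * X * T * algebraMap ℂ _ p - 288 * X * T ^ 2 * algebraMap ℂ _ p + 192 * X * Y * T ^ 2
    * algebraMap ℂ _ p * algebraMap ℂ _ q + 72 * X ^ 2 * T ^ 2 + 864 * X ^ 2 * T ^ 3 - 384 *
    X ^ 2 * Y * T ^ 3 * algebraMap ℂ _ q - 192 * X ^ 3 * T ^ 3 * algebraMap ℂ _ p

/-- The coefficient of the exponential in a derivative of `8 * expSol p q`. -/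
noncomputable def expCoeff10 (p q : ℂ) : smoothFunctions :=
  54 * T * algebraMap ℂ _ p - 1008 * T ^ 2 * algebraMap ℂ _ p - 72 * Y * T * algebraMap ℂ _
    p * algebraMap ℂ _ q + 576 * Y * T ^ 2 * algebraMap ℂ _ p * algebraMap ℂ _ q - 27 * X *
    T - 324 * X * T ^ 2 + 5184 * X * T ^ 3 + 432 * X * Y * T ^ 2 * algebraMap ℂ _ q - 2304 *
    X * Y * T ^ 3 * algebraMap ℂ _ q + 216 * X ^ 2 * T ^ 2 * algebraMap ℂ _ p + 2880 * X ^ 2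
    * T ^ 3 * algebraMap ℂ _ p - 2304 * X ^ 2 * Y * T ^ 3 * algebraMap ℂ _ p * algebraMap ℂ
    _ q - 864 * X ^ 3 * T ^ 3 - 10368 * X ^ 3 * T ^ 4 + 4608 * X ^ 3 * Y * T ^ 4 *
    algebraMap ℂ _ q + 2304 * X ^ 4 * T ^ 4 * algebraMap ℂ _ p

/-- The coefficient of the exponential in a derivative of `16 * expSol p q`. -/
noncomputable def expCoeff20 (p q : ℂ) : smoothFunctions :=
  27 * T - 2160 * T ^ 2 + 10368 * T ^ 3 - 108 * Y * T * algebraMap ℂ _ q + 1728 * Y * T ^ 2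
    * algebraMap ℂ _ q - 4608 * Y * T ^ 3 * algebraMap ℂ _ q - 54 * X * T * algebraMap ℂ _ p
    + 29952 * X * T ^ 3 * algebraMap ℂ _ p + 1152 * X * Y * T ^ 2 * algebraMap ℂ _ p *
    algebraMap ℂ _ q - 18432 * X * Y * T ^ 3 * algebraMap ℂ _ p * algebraMap ℂ _ q + 432 * X
    ^ 2 * T ^ 2 + 1728 * X ^ 2 * T ^ 3 - 124416 * X ^ 2 * T ^ 4 - 6912 * X ^ 2 * Y * T ^ 3 *
    algebraMap ℂ _ q + 55296 * X ^ 2 * Y * T ^ 4 * algebraMap ℂ _ q - 3456 * X ^ 3 * T ^ 3 *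
    algebraMap ℂ _ p - 36864 * X ^ 3 * T ^ 4 * algebraMap ℂ _ p + 36864 * X ^ 3 * Y * T ^ 4
    * algebraMap ℂ _ p * algebraMap ℂ _ q + 13824 * X ^ 4 * T ^ 4 + 165888 * X ^ 4 * T ^ 5 -
    73728 * X ^ 4 * Y * T ^ 5 * algebraMap ℂ _ q - 36864 * X ^ 5 * T ^ 5 * algebraMap ℂ _ p

/-- The coefficient of the exponential in a derivative of `32 * expSol p q`. -/
noncomputable def expCoeff30 (p q : ℂ) : smoothFunctions :=
  -54 * T * algebraMap ℂ _ p - 4320 * T ^ 2 * algebraMap ℂ _ p + 80640 * T ^ 3 * algebraMap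
    ℂ _ p - 216 * Y * T * algebraMap ℂ _ p * algebraMap ℂ _ q + 5760 * Y * T ^ 2 *
    algebraMap ℂ _ p * algebraMap ℂ _ q - 46080 * Y * T ^ 3 * algebraMap ℂ _ p * algebraMap
    ℂ _ q - 81 * X * T + 1620 * X * T ^ 2 + 69120 * X * T ^ 3 - 622080 * X * T ^ 4 + 2160 *
    X * Y * T ^ 2 * algebraMap ℂ _ q - 69120 * X * Y * T ^ 3 * algebraMap ℂ _ q + 276480 * X
    * Y * T ^ 4 * algebraMap ℂ _ q + 1080 * X ^ 2 * T ^ 2 * algebraMap ℂ _ p - 17280 * X ^ 2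
    * T ^ 3 * algebraMap ℂ _ p - 829440 * X ^ 2 * T ^ 4 * algebraMap ℂ _ p - 23040 * X ^ 2 *
    Y * T ^ 3 * algebraMap ℂ _ p * algebraMap ℂ _ q + 552960 * X ^ 2 * Y * T ^ 4 *
    algebraMap ℂ _ p * algebraMap ℂ _ q - 8640 * X ^ 3 * T ^ 3 + 34560 * X ^ 3 * T ^ 4 +
    3317760 * X ^ 3 * T ^ 5 + 138240 * X ^ 3 * Y * T ^ 4 * algebraMap ℂ _ q - 1474560 * X ^
    3 * Y * T ^ 5 * algebraMap ℂ _ q + 69120 * X ^ 4 * T ^ 4 * algebraMap ℂ _ p + 552960 * X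
    ^ 4 * T ^ 5 * algebraMap ℂ _ p - 737280 * X ^ 4 * Y * T ^ 5 * algebraMap ℂ _ p *
    algebraMap ℂ _ q - 276480 * X ^ 5 * T ^ 5 - 3317760 * X ^ 5 * T ^ 6 + 1474560 * X ^ 5 *
    Y * T ^ 6 * algebraMap ℂ _ q + 737280 * X ^ 6 * T ^ 6 * algebraMap ℂ _ p

/-- The coefficient of the exponential in a derivative of `64 * expSol p q`. -/
noncomputable def expCoeff40 (p q : ℂ) : smoothFunctions :=
  -243 * T - 3240 * T ^ 2 + 259200 * T ^ 3 - 1244160 * T ^ 4 - 324 * Y * T * algebraMap ℂ _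
    q + 12960 * Y * T ^ 2 * algebraMap ℂ _ q - 207360 * Y * T ^ 3 * algebraMap ℂ _ q +
    552960 * Y * T ^ 4 * algebraMap ℂ _ q - 162 * X * T * algebraMap ℂ _ p + 7776 * X * T ^
    2 * algebraMap ℂ _ p + 103680 * X * T ^ 3 * algebraMap ℂ _ p - 5529600 * X * T ^ 4 *
    algebraMap ℂ _ p + 5184 * X * Y * T ^ 2 * algebraMap ℂ _ p * algebraMap ℂ _ q - 276480 *
    X * Y * T ^ 3 * algebraMap ℂ _ p * algebraMap ℂ _ q + 3317760 * X * Y * T ^ 4 *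
    algebraMap ℂ _ p * algebraMap ℂ _ q + 1944 * X ^ 2 * T ^ 2 - 90720 * X ^ 2 * T ^ 3 -
    1866240 * X ^ 2 * T ^ 4 + 29859840 * X ^ 2 * T ^ 5 - 51840 * X ^ 2 * Y * T ^ 3 *
    algebraMap ℂ _ q + 2488320 * X ^ 2 * Y * T ^ 4 * algebraMap ℂ _ q - 13271040 * X ^ 2 * Y
    * T ^ 5 * algebraMap ℂ _ q - 25920 * X ^ 3 * T ^ 3 * algebraMap ℂ _ p + 829440 * X ^ 3 *
    T ^ 4 * algebraMap ℂ _ p + 24330240 * X ^ 3 * T ^ 5 * algebraMap ℂ _ p + 552960 * X ^ 3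
    * Y * T ^ 4 * algebraMap ℂ _ p * algebraMap ℂ _ q - 17694720 * X ^ 3 * Y * T ^ 5 *
    algebraMap ℂ _ p * algebraMap ℂ _ q + 207360 * X ^ 4 * T ^ 4 - 2488320 * X ^ 4 * T ^ 5 -
    99532800 * X ^ 4 * T ^ 6 - 3317760 * X ^ 4 * Y * T ^ 5 * algebraMap ℂ _ q + 44236800 * X
    ^ 4 * Y * T ^ 6 * algebraMap ℂ _ q - 1658880 * X ^ 5 * T ^ 5 * algebraMap ℂ _ p -
    8847360 * X ^ 5 * T ^ 6 * algebraMap ℂ _ p + 17694720 * X ^ 5 * Y * T ^ 6 * algebraMap ℂ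
    _ p * algebraMap ℂ _ q + 6635520 * X ^ 6 * T ^ 6 + 79626240 * X ^ 6 * T ^ 7 - 35389440 *
    X ^ 6 * Y * T ^ 7 * algebraMap ℂ _ q - 17694720 * X ^ 7 * T ^ 7 * algebraMap ℂ _ p

/-- The coefficient of the exponential in a derivative of `16 * expSol p q`. -/
noncomputable def expCoeff01 (p q : ℂ) : smoothFunctions :=
  324 * T * algebraMap ℂ _ q - 2880 * T ^ 2 * algebraMap ℂ _ q + 4608 * T ^ 3 * algebraMap ℂ
    _ q + 27 * Y * T - 432 * Y * T ^ 2 + 3456 * Y * T ^ 3 - 72 * X * T * algebraMap ℂ _ p *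
    algebraMap ℂ _ q - 3456 * X * T ^ 2 * algebraMap ℂ _ p * algebraMap ℂ _ q + 9216 * X * T
    ^ 3 * algebraMap ℂ _ p * algebraMap ℂ _ q + 4608 * X * Y * T ^ 3 * algebraMap ℂ _ p +
    12672 * X ^ 2 * T ^ 3 * algebraMap ℂ _ q - 27648 * X ^ 2 * T ^ 4 * algebraMap ℂ _ q -
    864 * X ^ 2 * Y * T ^ 3 - 20736 * X ^ 2 * Y * T ^ 4 + 2304 * X ^ 3 * T ^ 3 * algebraMap
    ℂ _ p * algebraMap ℂ _ q + 4608 * X ^ 3 * Y * T ^ 4 * algebraMap ℂ _ p - 9216 * X ^ 4 *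
    T ^ 4 * algebraMap ℂ _ q

/-- The coefficient of the exponential in a derivative of `64 * expSol p q`. -/
noncomputable def expCoeff02 (p q : ℂ) : smoothFunctions :=
  -351 * T + 7992 * T ^ 2 - 93312 * T ^ 3 + 248832 * T ^ 4 + 108 * Y * T * algebraMap ℂ _ q
    - 4320 * Y * T ^ 2 * algebraMap ℂ _ q + 59904 * Y * T ^ 3 * algebraMap ℂ _ q - 110592 *
    Y * T ^ 4 * algebraMap ℂ _ q + 54 * X * T * algebraMap ℂ _ p + 2592 * X * T ^ 2 *
    algebraMap ℂ _ p - 99072 * X * T ^ 3 * algebraMap ℂ _ p + 331776 * X * T ^ 4 *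
    algebraMap ℂ _ p + 576 * X * Y * T ^ 2 * algebraMap ℂ _ p * algebraMap ℂ _ q + 73728 * X
    * Y * T ^ 3 * algebraMap ℂ _ p * algebraMap ℂ _ q - 221184 * X * Y * T ^ 4 * algebraMap
    ℂ _ p * algebraMap ℂ _ q + 216 * X ^ 2 * T ^ 2 + 864 * X ^ 2 * T ^ 3 + 622080 * X ^ 2 *
    T ^ 4 - 1990656 * X ^ 2 * T ^ 5 - 3456 * X ^ 2 * Y * T ^ 3 * algebraMap ℂ _ q - 387072 *
    X ^ 2 * Y * T ^ 4 * algebraMap ℂ _ q + 884736 * X ^ 2 * Y * T ^ 5 * algebraMap ℂ _ q -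
    1728 * X ^ 3 * T ^ 3 * algebraMap ℂ _ p - 18432 * X ^ 3 * T ^ 4 * algebraMap ℂ _ p +
    442368 * X ^ 3 * T ^ 5 * algebraMap ℂ _ p - 36864 * X ^ 3 * Y * T ^ 4 * algebraMap ℂ _ p
    * algebraMap ℂ _ q - 13824 * X ^ 4 * T ^ 4 - 663552 * X ^ 4 * T ^ 5 + 294912 * X ^ 4 * Y
    * T ^ 5 * algebraMap ℂ _ q + 147456 * X ^ 5 * T ^ 5 * algebraMap ℂ _ p

/-- The coefficient of the exponential in a derivative of `16 * expSol p q`. -/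
noncomputable def expCoeff11 (p q : ℂ) : smoothFunctions :=
  252 * T * algebraMap ℂ _ p * algebraMap ℂ _ q - 6336 * T ^ 2 * algebraMap ℂ _ p *
    algebraMap ℂ _ q + 13824 * T ^ 3 * algebraMap ℂ _ p * algebraMap ℂ _ q + 27 * Y * T *
    algebraMap ℂ _ p - 432 * Y * T ^ 2 * algebraMap ℂ _ p + 8064 * Y * T ^ 3 * algebraMap ℂ
    _ p - 54 * X * T * algebraMap ℂ _ q - 3240 * X * T ^ 2 * algebraMap ℂ _ q + 43776 * X *
    T ^ 3 * algebraMap ℂ _ q - 82944 * X * T ^ 4 * algebraMap ℂ _ q - 54 * X * Y * T ^ 2 +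
    3456 * X * Y * T ^ 3 - 62208 * X * Y * T ^ 4 + 144 * X ^ 2 * T ^ 2 * algebraMap ℂ _ p *
    algebraMap ℂ _ q + 33408 * X ^ 2 * T ^ 3 * algebraMap ℂ _ p * algebraMap ℂ _ q - 82944 *
    X ^ 2 * T ^ 4 * algebraMap ℂ _ p * algebraMap ℂ _ q - 864 * X ^ 2 * Y * T ^ 3 *
    algebraMap ℂ _ p - 34560 * X ^ 2 * Y * T ^ 4 * algebraMap ℂ _ p + 1728 * X ^ 3 * T ^ 3 *
    algebraMap ℂ _ q - 112896 * X ^ 3 * T ^ 4 * algebraMap ℂ _ q + 221184 * X ^ 3 * T ^ 5 *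
    algebraMap ℂ _ q + 8640 * X ^ 3 * Y * T ^ 4 + 165888 * X ^ 3 * Y * T ^ 5 - 23040 * X ^ 4
    * T ^ 4 * algebraMap ℂ _ p * algebraMap ℂ _ q - 36864 * X ^ 4 * Y * T ^ 5 * algebraMap ℂ
    _ p + 73728 * X ^ 5 * T ^ 5 * algebraMap ℂ _ q

/-- The coefficient of the exponential in a derivative of `64 * expSol p q`. -/
noncomputable def expCoeff21 (p q : ℂ) : smoothFunctions :=
  540 * T * algebraMap ℂ _ q - 31968 * T ^ 2 * algebraMap ℂ _ q + 216576 * T ^ 3 *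
    algebraMap ℂ _ q - 331776 * T ^ 4 * algebraMap ℂ _ q + 81 * Y * T - 1512 * Y * T ^ 2 +
    38016 * Y * T ^ 3 - 248832 * Y * T ^ 4 - 216 * X * T * algebraMap ℂ _ p * algebraMap ℂ _
    q - 13824 * X * T ^ 2 * algebraMap ℂ _ p * algebraMap ℂ _ q + 543744 * X * T ^ 3 *
    algebraMap ℂ _ p * algebraMap ℂ _ q - 1327104 * X * T ^ 4 * algebraMap ℂ _ p *
    algebraMap ℂ _ q - 432 * X * Y * T ^ 2 * algebraMap ℂ _ p + 13824 * X * Y * T ^ 3 *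
    algebraMap ℂ _ p - 718848 * X * Y * T ^ 4 * algebraMap ℂ _ p + 864 * X ^ 2 * T ^ 2 *
    algebraMap ℂ _ q + 172800 * X ^ 2 * T ^ 3 * algebraMap ℂ _ q - 2654208 * X ^ 2 * T ^ 4 *
    algebraMap ℂ _ q + 5308416 * X ^ 2 * T ^ 5 * algebraMap ℂ _ q - 1728 * X ^ 2 * Y * T ^ 3
    - 82944 * X ^ 2 * Y * T ^ 4 + 3981312 * X ^ 2 * Y * T ^ 5 + 4608 * X ^ 3 * T ^ 3 *
    algebraMap ℂ _ p * algebraMap ℂ _ q - 1622016 * X ^ 3 * T ^ 4 * algebraMap ℂ _ p *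
    algebraMap ℂ _ q + 3538944 * X ^ 3 * T ^ 5 * algebraMap ℂ _ p * algebraMap ℂ _ q + 55296
    * X ^ 3 * Y * T ^ 4 * algebraMap ℂ _ p + 1179648 * X ^ 3 * Y * T ^ 5 * algebraMap ℂ _ p
    - 110592 * X ^ 4 * T ^ 4 * algebraMap ℂ _ q + 5087232 * X ^ 4 * T ^ 5 * algebraMap ℂ _ q
    - 8847360 * X ^ 4 * T ^ 6 * algebraMap ℂ _ q - 387072 * X ^ 4 * Y * T ^ 5 - 6635520 * X
    ^ 4 * Y * T ^ 6 + 1032192 * X ^ 5 * T ^ 5 * algebraMap ℂ _ p * algebraMap ℂ _ q +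
    1474560 * X ^ 5 * Y * T ^ 6 * algebraMap ℂ _ p - 2949120 * X ^ 6 * T ^ 6 * algebraMap ℂ
    _ q

/-- The coefficient of the exponential in a derivative of `64 * expSol p q`. -/
noncomputable def expCoeff31 (p q : ℂ) : smoothFunctions :=
  324 * T * algebraMap ℂ _ p * algebraMap ℂ _ q - 45792 * T ^ 2 * algebraMap ℂ _ p *
    algebraMap ℂ _ q + 760320 * T ^ 3 * algebraMap ℂ _ p * algebraMap ℂ _ q - 1658880 * T ^
    4 * algebraMap ℂ _ p * algebraMap ℂ _ q + 81 * Y * T * algebraMap ℂ _ p - 1944 * Y * T ^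
    2 * algebraMap ℂ _ p + 51840 * Y * T ^ 3 * algebraMap ℂ _ p - 967680 * Y * T ^ 4 *
    algebraMap ℂ _ p - 162 * X * T * algebraMap ℂ _ q - 9720 * X * T ^ 2 * algebraMap ℂ _ q
    + 881280 * X * T ^ 3 * algebraMap ℂ _ q - 7603200 * X * T ^ 4 * algebraMap ℂ _ q +
    13271040 * X * T ^ 5 * algebraMap ℂ _ q - 486 * X * Y * T ^ 2 + 12960 * X * Y * T ^ 3 -
    933120 * X * Y * T ^ 4 + 9953280 * X * Y * T ^ 5 + 1296 * X ^ 2 * T ^ 2 * algebraMap ℂ _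
    p * algebraMap ℂ _ q + 241920 * X ^ 2 * T ^ 3 * algebraMap ℂ _ p * algebraMap ℂ _ q -
    10782720 * X ^ 2 * T ^ 4 * algebraMap ℂ _ p * algebraMap ℂ _ q + 26542080 * X ^ 2 * T ^
    5 * algebraMap ℂ _ p * algebraMap ℂ _ q + 13271040 * X ^ 2 * Y * T ^ 5 * algebraMap ℂ _
    p - 2695680 * X ^ 3 * T ^ 4 * algebraMap ℂ _ q + 44236800 * X ^ 3 * T ^ 5 * algebraMap ℂ
    _ q - 88473600 * X ^ 3 * T ^ 6 * algebraMap ℂ _ q + 51840 * X ^ 3 * Y * T ^ 4 - 66355200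
    * X ^ 3 * Y * T ^ 6 - 138240 * X ^ 4 * T ^ 4 * algebraMap ℂ _ p * algebraMap ℂ _ q +
    23224320 * X ^ 4 * T ^ 5 * algebraMap ℂ _ p * algebraMap ℂ _ q - 44236800 * X ^ 4 * T ^
    6 * algebraMap ℂ _ p * algebraMap ℂ _ q - 829440 * X ^ 4 * Y * T ^ 5 * algebraMap ℂ _ p
    - 11059200 * X ^ 4 * Y * T ^ 6 * algebraMap ℂ _ p + 1658880 * X ^ 5 * T ^ 5 * algebraMap
    ℂ _ q - 68567040 * X ^ 5 * T ^ 6 * algebraMap ℂ _ q + 106168320 * X ^ 5 * T ^ 7 *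
    algebraMap ℂ _ q + 4976640 * X ^ 5 * Y * T ^ 6 + 79626240 * X ^ 5 * Y * T ^ 7 - 13271040
    * X ^ 6 * T ^ 6 * algebraMap ℂ _ p * algebraMap ℂ _ q - 17694720 * X ^ 6 * Y * T ^ 7 *
    algebraMap ℂ _ p + 35389440 * X ^ 7 * T ^ 7 * algebraMap ℂ _ q

/-- The tabulated coefficients are reduced modulo `T_mul` and the quadratic relations for `p` and
`q`, so they are at most linear in `Y`, `p` and `q`. Each later derivative needs one differentiation
followed by one reduction; the numerical prefactors clear the denominators of p² and q². -/
theorem expSol_eq (hp : 4 * p ^ 2 = 3) (hq : 16 * q ^ 2 = -3) :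
    4 * expSol p q = expo p q * expCoeff00 p q := by
  have hp' := algebraMap_relation hp
  have hq' := algebraMap_relation' hq
  rw [expSol, dx_expo_mul, dx_expo_mul]
  simp only [expCoeff00,
    Derivation.leibniz, Derivation.leibniz_pow, smul_eq_mul, nsmul_eq_mul, dx_X, dx_Y, dx_T, dy_X,
    dy_Y, dy_T, derivation_ofNat, Derivation.map_algebraMap, map_add, map_sub, map_neg, map_zero,
    Nat.cast_ofNat, mul_zero, zero_mul, add_zero, zero_add, sub_zero, neg_zero, mul_one,
    Nat.add_one_sub_one, pow_one]
  grind [T_mul]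

theorem dx_expSol (hp : 4 * p ^ 2 = 3) (hq : 16 * q ^ 2 = -3) :
    8 * dx (expSol p q) = expo p q * expCoeff10 p q := by
  have hp' := algebraMap_relation hp
  have hq' := algebraMap_relation' hq
  have h := congrArg dx (expSol_eq hp hq)
  rw [derivation_ofNat_mul, dx_expo_mul] at h
  have key : 2 * (dx (expCoeff00 p q) + algebraMap ℂ _ p * expCoeff00 p q) = expCoeff10 p q := by
    simp only [expCoeff00, expCoeff10,
      Derivation.leibniz, Derivation.leibniz_pow, smul_eq_mul, nsmul_eq_mul, dx_X, dx_Y, dx_T, dy_X,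
      dy_Y, dy_T, derivation_ofNat, Derivation.map_algebraMap, map_add, map_sub, map_neg, map_zero,
      Nat.cast_ofNat, mul_zero, zero_mul, add_zero, zero_add, sub_zero, neg_zero, mul_one,
      Nat.add_one_sub_one, pow_one]
    grind [T_mul]
  linear_combination 2 * h + expo p q * key

theorem dx_dx_expSol (hp : 4 * p ^ 2 = 3) (hq : 16 * q ^ 2 = -3) :
    16 * dx (dx (expSol p q)) = expo p q * expCoeff20 p q := by
  have hp' := algebraMap_relation hp
  have hq' := algebraMap_relation' hq
  have h := congrArg dx (dx_expSol hp hq)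
  rw [derivation_ofNat_mul, dx_expo_mul] at h
  have key : 2 * (dx (expCoeff10 p q) + algebraMap ℂ _ p * expCoeff10 p q) = expCoeff20 p q := by
    simp only [expCoeff10, expCoeff20,
      Derivation.leibniz, Derivation.leibniz_pow, smul_eq_mul, nsmul_eq_mul, dx_X, dx_Y, dx_T, dy_X,
      dy_Y, dy_T, derivation_ofNat, Derivation.map_algebraMap, map_add, map_sub, map_neg, map_zero,
      Nat.cast_ofNat, mul_zero, zero_mul, add_zero, zero_add, sub_zero, neg_zero, mul_one,
      Nat.add_one_sub_one, pow_one]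
    grind [T_mul]
  linear_combination 2 * h + expo p q * key

theorem dx_dx_dx_expSol (hp : 4 * p ^ 2 = 3) (hq : 16 * q ^ 2 = -3) :
    32 * dx (dx (dx (expSol p q))) = expo p q * expCoeff30 p q := by
  have hp' := algebraMap_relation hp
  have hq' := algebraMap_relation' hq
  have h := congrArg dx (dx_dx_expSol hp hq)
  rw [derivation_ofNat_mul, dx_expo_mul] at h
  have key : 2 * (dx (expCoeff20 p q) + algebraMap ℂ _ p * expCoeff20 p q) = expCoeff30 p q := by
    simp only [expCoeff20, expCoeff30,
      Derivation.leibniz, Derivation.leibniz_pow, smul_eq_mul, nsmul_eq_mul, dx_X, dx_Y, dx_T, dy_X,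
      dy_Y, dy_T, derivation_ofNat, Derivation.map_algebraMap, map_add, map_sub, map_neg, map_zero,
      Nat.cast_ofNat, mul_zero, zero_mul, add_zero, zero_add, sub_zero, neg_zero, mul_one,
      Nat.add_one_sub_one, pow_one]
    grind [T_mul]
  linear_combination 2 * h + expo p q * key

theorem dx_dx_dx_dx_expSol (hp : 4 * p ^ 2 = 3) (hq : 16 * q ^ 2 = -3) :
    64 * dx (dx (dx (dx (expSol p q)))) = expo p q * expCoeff40 p q := by
  have hp' := algebraMap_relation hp
  have hq' := algebraMap_relation' hq
  have h := congrArg dx (dx_dx_dx_expSol hp hq)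
  rw [derivation_ofNat_mul, dx_expo_mul] at h
  have key : 2 * (dx (expCoeff30 p q) + algebraMap ℂ _ p * expCoeff30 p q) = expCoeff40 p q := by
    simp only [expCoeff30, expCoeff40,
      Derivation.leibniz, Derivation.leibniz_pow, smul_eq_mul, nsmul_eq_mul, dx_X, dx_Y, dx_T, dy_X,
      dy_Y, dy_T, derivation_ofNat, Derivation.map_algebraMap, map_add, map_sub, map_neg, map_zero,
      Nat.cast_ofNat, mul_zero, zero_mul, add_zero, zero_add, sub_zero, neg_zero, mul_one,
      Nat.add_one_sub_one, pow_one]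
    grind [T_mul]
  linear_combination 2 * h + expo p q * key

theorem dy_expSol (hp : 4 * p ^ 2 = 3) (hq : 16 * q ^ 2 = -3) :
    16 * dy (expSol p q) = expo p q * expCoeff01 p q := by
  have hp' := algebraMap_relation hp
  have hq' := algebraMap_relation' hq
  have h := congrArg dy (expSol_eq hp hq)
  rw [derivation_ofNat_mul, dy_expo_mul] at h
  have key : 4 * (dy (expCoeff00 p q) + algebraMap ℂ _ q * expCoeff00 p q) = expCoeff01 p q := by
    simp only [expCoeff00, expCoeff01,
      Derivation.leibniz, Derivation.leibniz_pow, smul_eq_mul, nsmul_eq_mul, dx_X, dx_Y, dx_T, dy_X,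
      dy_Y, dy_T, derivation_ofNat, Derivation.map_algebraMap, map_add, map_sub, map_neg, map_zero,
      Nat.cast_ofNat, mul_zero, zero_mul, add_zero, zero_add, sub_zero, neg_zero, mul_one,
      Nat.add_one_sub_one, pow_one]
    grind [T_mul]
  linear_combination 4 * h + expo p q * key

theorem dy_dy_expSol (hp : 4 * p ^ 2 = 3) (hq : 16 * q ^ 2 = -3) :
    64 * dy (dy (expSol p q)) = expo p q * expCoeff02 p q := by
  have hp' := algebraMap_relation hp
  have hq' := algebraMap_relation' hq
  have h := congrArg dy (dy_expSol hp hq)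
  rw [derivation_ofNat_mul, dy_expo_mul] at h
  have key : 4 * (dy (expCoeff01 p q) + algebraMap ℂ _ q * expCoeff01 p q) = expCoeff02 p q := by
    simp only [expCoeff01, expCoeff02,
      Derivation.leibniz, Derivation.leibniz_pow, smul_eq_mul, nsmul_eq_mul, dx_X, dx_Y, dx_T, dy_X,
      dy_Y, dy_T, derivation_ofNat, Derivation.map_algebraMap, map_add, map_sub, map_neg, map_zero,
      Nat.cast_ofNat, mul_zero, zero_mul, add_zero, zero_add, sub_zero, neg_zero, mul_one,
      Nat.add_one_sub_one, pow_one]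
    grind [T_mul]
  linear_combination 4 * h + expo p q * key

theorem dx_dy_expSol (hp : 4 * p ^ 2 = 3) (hq : 16 * q ^ 2 = -3) :
    16 * dx (dy (expSol p q)) = expo p q * expCoeff11 p q := by
  have hp' := algebraMap_relation hp
  have hq' := algebraMap_relation' hq
  have h := congrArg dx (dy_expSol hp hq)
  rw [derivation_ofNat_mul, dx_expo_mul] at h
  have key : (dx (expCoeff01 p q) + algebraMap ℂ _ p * expCoeff01 p q) = expCoeff11 p q := by
    simp only [expCoeff01, expCoeff11,
      Derivation.leibniz, Derivation.leibniz_pow, smul_eq_mul, nsmul_eq_mul, dx_X, dx_Y, dx_T, dy_X,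
      dy_Y, dy_T, derivation_ofNat, Derivation.map_algebraMap, map_add, map_sub, map_neg, map_zero,
      Nat.cast_ofNat, mul_zero, zero_mul, add_zero, zero_add, sub_zero, neg_zero, mul_one,
      Nat.add_one_sub_one, pow_one]
    grind [T_mul]
  linear_combination h + expo p q * key

theorem dx_dx_dy_expSol (hp : 4 * p ^ 2 = 3) (hq : 16 * q ^ 2 = -3) :
    64 * dx (dx (dy (expSol p q))) = expo p q * expCoeff21 p q := by
  have hp' := algebraMap_relation hp
  have hq' := algebraMap_relation' hq
  have h := congrArg dx (dx_dy_expSol hp hq)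
  rw [derivation_ofNat_mul, dx_expo_mul] at h
  have key : 4 * (dx (expCoeff11 p q) + algebraMap ℂ _ p * expCoeff11 p q) = expCoeff21 p q := by
    simp only [expCoeff11, expCoeff21,
      Derivation.leibniz, Derivation.leibniz_pow, smul_eq_mul, nsmul_eq_mul, dx_X, dx_Y, dx_T, dy_X,
      dy_Y, dy_T, derivation_ofNat, Derivation.map_algebraMap, map_add, map_sub, map_neg, map_zero,
      Nat.cast_ofNat, mul_zero, zero_mul, add_zero, zero_add, sub_zero, neg_zero, mul_one,
      Nat.add_one_sub_one, pow_one]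
    grind [T_mul]
  linear_combination 4 * h + expo p q * key

theorem dx_dx_dx_dy_expSol (hp : 4 * p ^ 2 = 3) (hq : 16 * q ^ 2 = -3) :
    64 * dx (dx (dx (dy (expSol p q)))) = expo p q * expCoeff31 p q := by
  have hp' := algebraMap_relation hp
  have hq' := algebraMap_relation' hq
  have h := congrArg dx (dx_dx_dy_expSol hp hq)
  rw [derivation_ofNat_mul, dx_expo_mul] at h
  have key : (dx (expCoeff21 p q) + algebraMap ℂ _ p * expCoeff21 p q) = expCoeff31 p q := by
    simp only [expCoeff21, expCoeff31,
      Derivation.leibniz, Derivation.leibniz_pow, smul_eq_mul, nsmul_eq_mul, dx_X, dx_Y, dx_T, dy_X,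
      dy_Y, dy_T, derivation_ofNat, Derivation.map_algebraMap, map_add, map_sub, map_neg, map_zero,
      Nat.cast_ofNat, mul_zero, zero_mul, add_zero, zero_add, sub_zero, neg_zero, mul_one,
      Nat.add_one_sub_one, pow_one]
    grind [T_mul]
  linear_combination h + expo p q * key

theorem annX_expSol (hp : 4 * p ^ 2 = 3) (hq : 16 * q ^ 2 = -3) :
    annX (expSol p q) = 0 := by
  have hp' := algebraMap_relation hp
  have hq' := algebraMap_relation' hq
  have h0 := expSol_eq hp hq
  have h1 := dx_expSol hp hq
  have h2 := dx_dx_expSol hp hq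
  have h3 := dx_dx_dx_expSol hp hq
  have h4 := dx_dx_dx_dx_expSol hp hq
  have h5 := dy_expSol hp hq
  -- The weights 1, 2, 4, 8, 4, 16 bring the prefactors 64, 32, 16, 8, 16, 4 of the tabulated
  -- derivatives to the common value 64.
  have key : 1 * (4 * expCoeff40 p q) + 2 * (24 * X * T * expCoeff30 p q) + 4 * ((-3 + 108 * T - 144 * X
      ^ 2 * T ^ 2) * expCoeff20 p q) + 8 * ((-12 * X * T - 576 * X * T ^ 2 + 576 * X ^ 3 * T
      ^ 3) * expCoeff10 p q) + 4 * (12 * Y * T * expCoeff01 p q) + 16 * ((-288 * T ^ 2 +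
      1440 * X ^ 2 * T ^ 3 - 1152 * X ^ 4 * T ^ 4) * expCoeff00 p q) = 0 := by
    simp only [expCoeff40, expCoeff30, expCoeff20, expCoeff10, expCoeff01, expCoeff00]
    grind [T_mul]
  have h64 : 64 * annX (expSol p q) = 0 := by
    unfold annX
    linear_combination 1 * 4 * h4 + 2 * 24 * X * T * h3 + 4 * (-3 + 108 * T - 144 * X ^ 2 * T ^ 2) * h2 + 8 * (-12
      * X * T - 576 * X * T ^ 2 + 576 * X ^ 3 * T ^ 3) * h1 + 4 * 12 * Y * T * h5 + 16 *
      (-288 * T ^ 2 + 1440 * X ^ 2 * T ^ 3 - 1152 * X ^ 4 * T ^ 4) * h0 + expo p q * key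
  exact eq_zero_of_ofNat_mul h64

theorem annY_expSol (hp : 4 * p ^ 2 = 3) (hq : 16 * q ^ 2 = -3) :
    annY (expSol p q) = 0 := by
  have hp' := algebraMap_relation hp
  have hq' := algebraMap_relation' hq
  have h0 := expSol_eq hp hq
  have h1 := dx_expSol hp hq
  have h2 := dx_dx_expSol hp hq
  have h3 := dx_dx_dx_expSol hp hq
  have h4 := dy_dy_expSol hp hq
  have h5 := dy_expSol hp hq
  have key : 1 * (4 * expCoeff02 p q) + 2 * (24 * X * T * expCoeff30 p q) + 4 * ((1 + 12 * T + 48 * X ^ 2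
      * T ^ 2) * expCoeff20 p q) + 8 * ((-12 * X * T + 576 * X * T ^ 2 - 960 * X ^ 3 * T ^
      3) * expCoeff10 p q) + 4 * (12 * Y * T * expCoeff01 p q) + 16 * ((288 * T ^ 2 - 3168 *
      X ^ 2 * T ^ 3 + 3456 * X ^ 4 * T ^ 4) * expCoeff00 p q) = 0 := by
    simp only [expCoeff02, expCoeff30, expCoeff20, expCoeff10, expCoeff01, expCoeff00]
    grind [T_mul]
  have h64 : 64 * annY (expSol p q) = 0 := by
    unfold annY
    linear_combination 1 * 4 * h4 + 2 * 24 * X * T * h3 + 4 * (1 + 12 * T + 48 * X ^ 2 * T ^ 2) * h2 + 8 * (-12 * X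
      * T + 576 * X * T ^ 2 - 960 * X ^ 3 * T ^ 3) * h1 + 4 * 12 * Y * T * h5 + 16 * (288 *
      T ^ 2 - 3168 * X ^ 2 * T ^ 3 + 3456 * X ^ 4 * T ^ 4) * h0 + expo p q * key
  exact eq_zero_of_ofNat_mul h64

end Exponential

/-! ### Unique continuation from the jet at the origin. -/

theorem hasDerivAt_ray (f : smoothFunctions) (z : ℂ) (t : ℝ) :
    HasDerivAt (fun s : ℝ => (f : ℂ → ℂ) (s * z))
      (z.re * (dx f : ℂ → ℂ) (t * z) + z.im * (dy f : ℂ → ℂ) (t * z)) t := by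
  have h1 : HasDerivAt (fun s : ℝ => (s : ℂ) * z) z t := by
    simpa using (Complex.ofRealCLM.hasDerivAt (x := t)).mul_const z
  have h2 := (differentiable_coe f (t * z)).hasFDerivAt.comp_hasDerivAt t h1
  refine h2.congr_deriv ?_
  have hz : z = z.re • (1 : ℂ) + z.im • Complex.I := by
    simp [Complex.re_add_im]
  have : ∀ L : ℂ →L[ℝ] ℂ, L z = z.re * L 1 + z.im * L Complex.I := by
    intro L
    conv_lhs => rw [hz]
    rw [map_add, map_smul, map_smul, Complex.real_smul, Complex.real_smul]
  exact this _

/-- A finite family of smooth functions that is closed under differentiation up to linear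
combinations vanishes as soon as it vanishes at the origin. -/
theorem eq_zero_of_span_closed {n : ℕ} (V : Fin n → smoothFunctions)
    (hx : ∀ i, dx (V i) ∈ Submodule.span smoothFunctions (Set.range V))
    (hy : ∀ i, dy (V i) ∈ Submodule.span smoothFunctions (Set.range V))
    (h0 : ∀ i, (V i : ℂ → ℂ) 0 = 0) (i : Fin n) : V i = 0 := by
  have hx' := fun i => (Submodule.mem_span_range_iff_exists_fun smoothFunctions).1 (hx i)
  have hy' := fun i => (Submodule.mem_span_range_iff_exists_fun smoothFunctions).1 (hy i)
  choose a ha using hx'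
  choose b hb using hy'
  ext z
  let v : ℝ → Fin n → ℂ := fun t i => (V i : ℂ → ℂ) (t * z)
  let m : Fin n → Fin n → ℝ → ℂ := fun i j t =>
    z.re * (a i j : ℂ → ℂ) (t * z) + z.im * (b i j : ℂ → ℂ) (t * z)
  have hm : ∀ i j, Continuous (m i j) := by
    intro i j
    have h1 := continuous_coe (a i j)
    have h2 := continuous_coe (b i j)
    fun_prop
  -- Closure under differentiation turns into a linear system v' = m v along the ray from 0 to z,
  -- with continuous coefficients.
  have hv : ∀ t, HasDerivAt v (fun i => ∑ j, m i j t * v t j) t := by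
    intro t
    rw [hasDerivAt_pi]
    intro i
    refine (hasDerivAt_ray (V i) z t).congr_deriv ?_
    rw [← ha, ← hb]
    simp only [AddSubmonoidClass.coe_finsetSum, Finset.sum_apply, Finset.mul_sum,
      ← Finset.sum_add_distrib]
    refine Finset.sum_congr rfl fun j _ => ?_
    change z.re * ((a i j : ℂ → ℂ) (t * z) * v t j)
      + z.im * ((b i j : ℂ → ℂ) (t * z) * v t j) = m i j t * v t j
    simp only [m]
    ring
  obtain ⟨K, hK⟩ : ∃ K, ∀ t ∈ Set.Icc (0 : ℝ) 1, ∑ i, ∑ j, ‖m i j t‖ ≤ K := by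
    have hc : Continuous fun t => ∑ i, ∑ j, ‖m i j t‖ :=
      continuous_finsetSum _ fun i _ => continuous_finsetSum _ fun j _ => (hm i j).norm
    obtain ⟨K, hK⟩ := (isCompact_Icc.image hc).bddAbove
    exact ⟨K, fun t ht => hK ⟨t, ht, rfl⟩⟩
  have hbound : ∀ t ∈ Set.Ico (0 : ℝ) 1, ‖fun i => ∑ j, m i j t * v t j‖ ≤ K * ‖v t‖ + 0 := by
    intro t ht
    have hKt := hK t ⟨ht.1, ht.2.le⟩
    rw [add_zero, pi_norm_le_iff_of_nonneg
      (mul_nonneg (le_trans (Finset.sum_nonneg fun i _ => Finset.sum_nonneg fun j _ =>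
        norm_nonneg _) hKt) (norm_nonneg _))]
    intro i
    calc ‖∑ j, m i j t * v t j‖ ≤ ∑ j, ‖m i j t‖ * ‖v t‖ :=
          norm_sum_le_of_le _ fun j _ => by
            rw [norm_mul]
            gcongr
            exact norm_le_pi_norm (v t) j
      _ = (∑ j, ‖m i j t‖) * ‖v t‖ := by rw [Finset.sum_mul]
      _ ≤ K * ‖v t‖ := by
          gcongr
          refine le_trans ?_ hKt
          exact Finset.single_le_sum (f := fun i => ∑ j, ‖m i j t‖)
            (fun i _ => Finset.sum_nonneg fun j _ => norm_nonneg _) (Finset.mem_univ i)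
  have hv0 : ‖v 0‖ ≤ 0 := by
    have : v 0 = 0 := by
      ext i
      simp [v, h0]
    simp [this]
  -- Grönwall with zero initial value (δ = 0) and no inhomogeneity (ε = 0) forces v to vanish at
  -- time 1, that is at z.
  have := norm_le_gronwallBound_of_norm_deriv_right_le (a := 0) (b := 1) (δ := 0) (K := K) (ε := 0)
    (fun t _ => (hv t).continuousAt.continuousWithinAt)
    (fun t _ => (hv t).hasDerivWithinAt) hv0 hbound 1 (by simp)
  rw [gronwallBound_ε0, zero_mul] at this
  have h1 : v 1 = 0 := norm_le_zero_iff.1 this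
  have := congrFun h1 i
  simpa [v] using this

theorem mem_of_ofNat_mul_mem {S : Submodule smoothFunctions smoothFunctions} {n : ℕ}
    [n.AtLeastTwo] {f : smoothFunctions} (h : ofNat(n) * f ∈ S) : f ∈ S := by
  have : f = algebraMap ℂ smoothFunctions (ofNat(n) : ℂ)⁻¹ • ((ofNat(n) : smoothFunctions) * f) := by
    rw [smul_eq_mul, ← mul_assoc, ← map_ofNat (algebraMap ℂ smoothFunctions), ← map_mul,
      inv_mul_cancel₀ (NeZero.ne _), map_one, one_mul]
  rw [this]
  exact S.smul_mem _ h

theorem derivation_mem_span {s : Set smoothFunctions}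
    {D : Derivation ℂ smoothFunctions smoothFunctions}
    (hD : ∀ f ∈ s, D f ∈ Submodule.span smoothFunctions s) {f : smoothFunctions}
    (hf : f ∈ Submodule.span smoothFunctions s) : D f ∈ Submodule.span smoothFunctions s := by
  induction hf using Submodule.span_induction with
  | mem f hf => exact hD f hf
  | zero => simp
  | add f g _ _ hf hg => rw [map_add]; exact add_mem hf hg
  | smul c f hf hf' =>
    rw [smul_eq_mul, Derivation.leibniz, smul_eq_mul, smul_eq_mul, mul_comm f]
    exact add_mem (Submodule.smul_mem _ _ hf') (Submodule.smul_mem _ _ hf)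

/-- The jet that parametrizes the common kernel of `annX` and `annY`. -/
noncomputable def jet (u : smoothFunctions) : Fin 8 → smoothFunctions :=
  ![u, dx u, dx (dx u), dx (dx (dx u)), dy u, dx (dy u), dx (dx (dy u)), dx (dx (dx (dy u)))]

/-- `annY` reduces ∂ᵧ²u and `annX` reduces ∂ₓ⁴u to the module spanned by the jet, so this module is
stable under both derivations and `eq_zero_of_span_closed` applies. -/
theorem eq_zero_of_jet_eq_zero {u : smoothFunctions} (hX : annX u = 0) (hY : annY u = 0)
    (h0 : ∀ i, (jet u i : ℂ → ℂ) 0 = 0) : u = 0 := by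
  set S := Submodule.span smoothFunctions (Set.range (jet u)) with hS
  have hmem : ∀ i, jet u i ∈ S := fun i => Submodule.subset_span ⟨i, rfl⟩
  have h00 : u ∈ S := hmem 0
  have h10 : dx u ∈ S := hmem 1
  have h20 : dx (dx u) ∈ S := hmem 2
  have h30 : dx (dx (dx u)) ∈ S := hmem 3
  have h01 : dy u ∈ S := hmem 4
  have h11 : dx (dy u) ∈ S := hmem 5
  have h21 : dx (dx (dy u)) ∈ S := hmem 6
  have h31 : dx (dx (dx (dy u))) ∈ S := hmem 7
  have hmul : ∀ c f : smoothFunctions, f ∈ S → c * f ∈ S := fun c f hf => S.smul_mem c hf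
  have h02 : dy (dy u) ∈ S := by
    refine mem_of_ofNat_mul_mem (n := 4) ?_
    have : 4 * dy (dy u) = -(24 * X * T * dx (dx (dx u))
      + (1 + 12 * T + 48 * X ^ 2 * T ^ 2) * dx (dx u)
      + (-12 * X * T + 576 * X * T ^ 2 - 960 * X ^ 3 * T ^ 3) * dx u + 12 * Y * T * dy u
      + (288 * T ^ 2 - 3168 * X ^ 2 * T ^ 3 + 3456 * X ^ 4 * T ^ 4) * u) := by
      rw [annY] at hY
      linear_combination hY
    rw [this]
    exact neg_mem (add_mem (add_mem (add_mem (add_mem (hmul _ _ h30) (hmul _ _ h20))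
      (hmul _ _ h10)) (hmul _ _ h01)) (hmul _ _ h00))
  have h4 : 4 * dx (dx (dx (dx u))) = -(24 * X * T * dx (dx (dx u))
      + (-3 + 108 * T - 144 * X ^ 2 * T ^ 2) * dx (dx u)
      + (-12 * X * T - 576 * X * T ^ 2 + 576 * X ^ 3 * T ^ 3) * dx u + 12 * Y * T * dy u
      + (-288 * T ^ 2 + 1440 * X ^ 2 * T ^ 3 - 1152 * X ^ 4 * T ^ 4) * u) := by
    rw [annX] at hX
    linear_combination hX
  have h40 : dx (dx (dx (dx u))) ∈ S := by
    refine mem_of_ofNat_mul_mem (n := 4) ?_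
    rw [h4]
    exact neg_mem (add_mem (add_mem (add_mem (add_mem (hmul _ _ h30) (hmul _ _ h20))
      (hmul _ _ h10)) (hmul _ _ h01)) (hmul _ _ h00))
  have hdy : ∀ c f : smoothFunctions, f ∈ S → dy f ∈ S → dy (c * f) ∈ S := by
    intro c f hf hf'
    rw [Derivation.leibniz, smul_eq_mul, smul_eq_mul, mul_comm f]
    exact add_mem (hmul _ _ hf') (hmul _ _ hf)
  -- The y-derivative of the equation `annX u = 0`; the term ∂ᵧ²u that it creates is already in `S`.
  have h41 : dx (dx (dx (dx (dy u)))) ∈ S := by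
    refine mem_of_ofNat_mul_mem (n := 4) ?_
    have := congrArg dy h4
    rw [derivation_ofNat_mul, dy_dx, dy_dx, dy_dx, dy_dx] at this
    rw [this, map_neg]
    refine neg_mem ?_
    simp only [map_add]
    refine add_mem (add_mem (add_mem (add_mem (hdy _ _ h30 ?_) (hdy _ _ h20 ?_))
      (hdy _ _ h10 ?_)) (hdy _ _ h01 h02)) (hdy _ _ h00 h01)
    · rwa [dy_dx, dy_dx, dy_dx]
    · rwa [dy_dx, dy_dx]
    · rwa [dy_dx]
  have hx : ∀ i, dx (jet u i) ∈ S := by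
    intro i
    fin_cases i
    exacts [h10, h20, h30, h40, h11, h21, h31, h41]
  -- Stability of all of `S` under ∂ₓ, and not just of its generators, is what places ∂ₓᵏ∂ᵧ²u in `S`
  -- below.
  have hdx : ∀ f ∈ S, dx f ∈ S := fun f hf => derivation_mem_span (by
    rintro _ ⟨i, rfl⟩
    exact hx i) hf
  have hy : ∀ i, dy (jet u i) ∈ S := by
    intro i
    fin_cases i
    · exact h01
    · change dy (dx u) ∈ S
      rwa [dy_dx]
    · change dy (dx (dx u)) ∈ S
      rwa [dy_dx, dy_dx]
    · change dy (dx (dx (dx u))) ∈ S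
      rwa [dy_dx, dy_dx, dy_dx]
    · exact h02
    · change dy (dx (dy u)) ∈ S
      rw [dy_dx]
      exact hdx _ h02
    · change dy (dx (dx (dy u))) ∈ S
      rw [dy_dx, dy_dx]
      exact hdx _ (hdx _ h02)
    · change dy (dx (dx (dx (dy u)))) ∈ S
      rw [dy_dx, dy_dx, dy_dx]
      exact hdx _ (hdx _ (hdx _ h02))
  exact eq_zero_of_span_closed (jet u) hx hy h0 0

/-! ### The jets of the eight solutions at the origin are a basis. -/

theorem add_coe (f g : smoothFunctions) (z : ℂ) :
    ((f + g : smoothFunctions) : ℂ → ℂ) z = (f : ℂ → ℂ) z + (g : ℂ → ℂ) z := rfl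

theorem mul_coe (f g : smoothFunctions) (z : ℂ) :
    ((f * g : smoothFunctions) : ℂ → ℂ) z = (f : ℂ → ℂ) z * (g : ℂ → ℂ) z := rfl

theorem neg_coe (f : smoothFunctions) (z : ℂ) :
    ((-f : smoothFunctions) : ℂ → ℂ) z = -(f : ℂ → ℂ) z := rfl

theorem sub_coe (f g : smoothFunctions) (z : ℂ) :
    ((f - g : smoothFunctions) : ℂ → ℂ) z = (f : ℂ → ℂ) z - (g : ℂ → ℂ) z := rfl

theorem smul_coe (c : ℂ) (f : smoothFunctions) (z : ℂ) :
    ((c • f : smoothFunctions) : ℂ → ℂ) z = c * (f : ℂ → ℂ) z := rfl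

theorem pow_coe (f : smoothFunctions) (n : ℕ) (z : ℂ) :
    ((f ^ n : smoothFunctions) : ℂ → ℂ) z = (f : ℂ → ℂ) z ^ n := rfl

theorem ofNat_coe (n : ℕ) [n.AtLeastTwo] (z : ℂ) :
    ((ofNat(n) : smoothFunctions) : ℂ → ℂ) z = ofNat(n) := rfl

theorem one_coe (z : ℂ) : ((1 : smoothFunctions) : ℂ → ℂ) z = 1 := rfl

theorem zero_coe (z : ℂ) : ((0 : smoothFunctions) : ℂ → ℂ) z = 0 := rfl

theorem algebraMap_coe (c z : ℂ) :
    ((algebraMap ℂ smoothFunctions c : smoothFunctions) : ℂ → ℂ) z = c := rfl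

theorem T_zero : (T : ℂ → ℂ) 0 = 1 / 3 := by simp [T_apply]

theorem X_zero : (X : ℂ → ℂ) 0 = 0 := by simp [X_apply]

theorem Y_zero : (Y : ℂ → ℂ) 0 = 0 := by simp [Y_apply]

theorem expo_zero (p q : ℂ) : (expo p q : ℂ → ℂ) 0 = 1 := by simp [expo_apply]

theorem annX_combination (c : ℂ) (f g : smoothFunctions) :
    annX (f + c • g) = annX f + c • annX g := by
  simp only [annX, map_add, Derivation.map_smul]
  simp only [Algebra.smul_def]
  ring

theorem annY_combination (c : ℂ) (f g : smoothFunctions) :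
    annY (f + c • g) = annY f + c • annY g := by
  simp only [annY, map_add, Derivation.map_smul]
  simp only [Algebra.smul_def]
  ring

/-- The values of the jet at the origin. -/
noncomputable def jetZero (u : smoothFunctions) (i : Fin 8) : ℂ := (jet u i : ℂ → ℂ) 0

theorem jetZero_combination (c : ℂ) (f g : smoothFunctions) :
    jetZero (f + c • g) = jetZero f + c • jetZero g := by
  have h : ∀ a b : smoothFunctions,
      ((a + c • b : smoothFunctions) : ℂ → ℂ) 0 = (a : ℂ → ℂ) 0 + c * (b : ℂ → ℂ) 0 :=
    fun _ _ => rfl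
  ext i
  fin_cases i <;> simp [jetZero, jet, map_add, Derivation.map_smul, h]

theorem jetZero_eq {u : smoothFunctions} {a₀ a₁ a₂ a₃ a₄ a₅ a₆ a₇ : ℂ}
    (h₀ : (u : ℂ → ℂ) 0 = a₀) (h₁ : (dx u : ℂ → ℂ) 0 = a₁) (h₂ : (dx (dx u) : ℂ → ℂ) 0 = a₂)
    (h₃ : (dx (dx (dx u)) : ℂ → ℂ) 0 = a₃) (h₄ : (dy u : ℂ → ℂ) 0 = a₄)
    (h₅ : (dx (dy u) : ℂ → ℂ) 0 = a₅) (h₆ : (dx (dx (dy u)) : ℂ → ℂ) 0 = a₆)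
    (h₇ : (dx (dx (dx (dy u))) : ℂ → ℂ) 0 = a₇) :
    jetZero u = ![a₀, a₁, a₂, a₃, a₄, a₅, a₆, a₇] := by
  ext i
  fin_cases i
  exacts [h₀, h₁, h₂, h₃, h₄, h₅, h₆, h₇]

theorem lump_x_eq : dx lumpFun = -24 * X * T ^ 2 + 32 * X ^ 3 * T ^ 3 := by
  simp only [lumpFun, map_add, map_sub, map_neg,
    Derivation.leibniz, Derivation.leibniz_pow, smul_eq_mul, nsmul_eq_mul, dx_X, dx_Y, dx_T, dy_X,
    dy_Y, dy_T, dy_dx, derivation_ofNat, map_zero, Nat.cast_ofNat, mul_zero, zero_mul, add_zero,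
    zero_add, sub_zero, neg_zero, mul_one, Nat.add_one_sub_one, pow_one]
  grind [T_mul]

theorem lump_y_eq : dy lumpFun = -8 * Y * T ^ 2 + 32 * X ^ 2 * Y * T ^ 3 := by
  simp only [lumpFun, map_add, map_sub, map_neg,
    Derivation.leibniz, Derivation.leibniz_pow, smul_eq_mul, nsmul_eq_mul, dx_X, dx_Y, dx_T, dy_X,
    dy_Y, dy_T, dy_dx, derivation_ofNat, map_zero, Nat.cast_ofNat, mul_zero, zero_mul, add_zero,
    zero_add, sub_zero, neg_zero, mul_one, Nat.add_one_sub_one, pow_one]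
  grind [T_mul]

theorem jetZero_lump_x : jetZero (dx lumpFun) = ![0, -8 / 3, 0, 160 / 9, 0, 0, 0, 0] := by
  rw [lump_x_eq]
  apply jetZero_eq
  all_goals
    simp only [map_add, map_sub, map_neg,
      Derivation.leibniz, Derivation.leibniz_pow, smul_eq_mul, nsmul_eq_mul, dx_X, dx_Y, dx_T, dy_X,
      dy_Y, dy_T, derivation_ofNat, map_zero, Nat.cast_ofNat, mul_zero, zero_mul, add_zero,
      zero_add, sub_zero, neg_zero, mul_one, Nat.add_one_sub_one, pow_one, add_coe, mul_coe,
      neg_coe, sub_coe, pow_coe, ofNat_coe, one_coe, zero_coe, X_zero, Y_zero, T_zero] <;>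
    norm_num

theorem jetZero_lump_y : jetZero (dy lumpFun) = ![0, 0, 0, 0, -8 / 9, 0, 32 / 9, 0] := by
  rw [lump_y_eq]
  apply jetZero_eq
  all_goals
    simp only [map_add, map_sub, map_neg,
      Derivation.leibniz, Derivation.leibniz_pow, smul_eq_mul, nsmul_eq_mul, dx_X, dx_Y, dx_T, dy_X,
      dy_Y, dy_T, derivation_ofNat, map_zero, Nat.cast_ofNat, mul_zero, zero_mul, add_zero,
      zero_add, sub_zero, neg_zero, mul_one, Nat.add_one_sub_one, pow_one, add_coe, mul_coe,
      neg_coe, sub_coe, pow_coe, ofNat_coe, one_coe, zero_coe, X_zero, Y_zero, T_zero] <;>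
    norm_num

theorem jetZero_evenSol : jetZero evenSol = ![-7, 0, 32, 0, 0, 0, 0, 0] := by
  rw [evenSol]
  apply jetZero_eq
  all_goals
    simp only [map_add, map_sub, map_neg, Derivation.map_one_eq_zero,
      Derivation.leibniz, Derivation.leibniz_pow, smul_eq_mul, nsmul_eq_mul, dx_X, dx_Y, dx_T, dy_X,
      dy_Y, dy_T, derivation_ofNat, map_zero, Nat.cast_ofNat, mul_zero, zero_mul, add_zero,
      zero_add, sub_zero, neg_zero, mul_one, Nat.add_one_sub_one, pow_one, add_coe, mul_coe,
      neg_coe, sub_coe, pow_coe, ofNat_coe, one_coe, zero_coe, X_zero, Y_zero, T_zero] <;>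
    norm_num

theorem jetZero_oddSol : jetZero oddSol = ![0, 0, 0, 0, 0, 25, 0, -160] := by
  rw [oddSol]
  apply jetZero_eq
  all_goals
    simp only [map_add, map_sub, map_neg, Derivation.map_one_eq_zero,
      Derivation.leibniz, Derivation.leibniz_pow, smul_eq_mul, nsmul_eq_mul, dx_X, dx_Y, dx_T, dy_X,
      dy_Y, dy_T, derivation_ofNat, map_zero, Nat.cast_ofNat, mul_zero, zero_mul, add_zero,
      zero_add, sub_zero, neg_zero, mul_one, Nat.add_one_sub_one, pow_one, add_coe, mul_coe,
      neg_coe, sub_coe, pow_coe, ofNat_coe, one_coe, zero_coe, X_zero, Y_zero, T_zero] <;>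
    norm_num

theorem jetZero_expSol {p q : ℂ} (hp : 4 * p ^ 2 = 3) (hq : 16 * q ^ 2 = -3) :
    jetZero (expSol p q) = ![-9 / 4, -47 / 4 * p, 153 / 16, 3733 / 48 * p, -31 / 12 * q,
      -27 / 4 * (p * q), 415 / 48 * q, 675 / 16 * (p * q)] := by
  have eval : ∀ {f g : smoothFunctions}, f = g → (f : ℂ → ℂ) 0 = (g : ℂ → ℂ) 0 := by
    rintro f _ rfl
    rfl
  apply jetZero_eq
  · have h := eval (expSol_eq hp hq)
    simp only [expCoeff00, add_coe, mul_coe, neg_coe, sub_coe, pow_coe, ofNat_coe, X_zero, Y_zero,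
      T_zero, expo_zero, algebraMap_coe] at h
    linear_combination h / 4
  · have h := eval (dx_expSol hp hq)
    simp only [expCoeff10, add_coe, mul_coe, neg_coe, sub_coe, pow_coe, ofNat_coe, X_zero, Y_zero,
      T_zero, expo_zero, algebraMap_coe] at h
    linear_combination h / 8
  · have h := eval (dx_dx_expSol hp hq)
    simp only [expCoeff20, add_coe, mul_coe, neg_coe, sub_coe, pow_coe, ofNat_coe, X_zero, Y_zero,
      T_zero, expo_zero, algebraMap_coe] at h
    linear_combination h / 16
  · have h := eval (dx_dx_dx_expSol hp hq)
    simp only [expCoeff30, add_coe, mul_coe, neg_coe, sub_coe, pow_coe, ofNat_coe, X_zero, Y_zero,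
      T_zero, expo_zero, algebraMap_coe] at h
    linear_combination h / 32
  · have h := eval (dy_expSol hp hq)
    simp only [expCoeff01, add_coe, mul_coe, neg_coe, sub_coe, pow_coe, ofNat_coe, X_zero, Y_zero,
      T_zero, expo_zero, algebraMap_coe] at h
    linear_combination h / 16
  · have h := eval (dx_dy_expSol hp hq)
    simp only [expCoeff11, add_coe, mul_coe, neg_coe, sub_coe, pow_coe, ofNat_coe, X_zero, Y_zero,
      T_zero, expo_zero, algebraMap_coe] at h
    linear_combination h / 16
  · have h := eval (dx_dx_dy_expSol hp hq)
    simp only [expCoeff21, add_coe, mul_coe, neg_coe, sub_coe, pow_coe, ofNat_coe, X_zero, Y_zero,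
      T_zero, expo_zero, algebraMap_coe] at h
    linear_combination h / 64
  · have h := eval (dx_dx_dx_dy_expSol hp hq)
    simp only [expCoeff31, add_coe, mul_coe, neg_coe, sub_coe, pow_coe, ofNat_coe, X_zero, Y_zero,
      T_zero, expo_zero, algebraMap_coe] at h
    linear_combination h / 64

/-- The eight explicit solutions span the common kernel of `annX` and `annY`. -/
theorem exists_combination {p q : ℂ} (hp : 4 * p ^ 2 = 3) (hq : 16 * q ^ 2 = -3)
    {u : smoothFunctions} (hX : annX u = 0) (hY : annY u = 0) :
    ∃ c₁ c₂ c₃ c₄ d₁ d₂ d₃ d₄ : ℂ,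
      u + c₁ • dx lumpFun + c₂ • dy lumpFun + c₃ • evenSol + c₄ • oddSol + d₁ • expSol p q
        + d₂ • expSol p (-q) + d₃ • expSol (-p) q + d₄ • expSol (-p) (-q) = 0 := by
  have hp' : 4 * (-p) ^ 2 = 3 := by rw [neg_sq, hp]
  have hq' : 16 * (-q) ^ 2 = -3 := by rw [neg_sq, hq]
  have hp0 : p ≠ 0 := by
    rintro rfl
    norm_num at hp
  have hq0 : q ≠ 0 := by
    rintro rfl
    norm_num at hq
  set w := jetZero u with hw
  -- By parity in x and in y the 8×8 system splits into four 2×2 systems, each pairing one rational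
  -- solution with one signed sum of the exponential ones. `A`, `B`, `C`, `D` are those signed sums
  -- of the dᵢ, found by Cramer's rule; up to sign the determinants are 81/16, 3/2, 3/2, 405/16,
  -- apart from factors `p`, `q`, `p * q` in the last three.
  let A : ℂ := 16 * (7 * w 2 + 32 * w 0) / 81
  let B : ℂ := (8 / 3 * w 3 + 160 / 9 * w 1) / (3 / 2) / p
  let C : ℂ := (8 / 9 * w 6 + 32 / 9 * w 4) / (3 / 2) / q
  let D : ℂ := (25 * w 7 + 160 * w 5) / (405 / 16) / (p * q)
  refine ⟨-(3733 / 48 * w 1 + 47 / 4 * w 3) / (3 / 2), -(415 / 48 * w 4 + 31 / 12 * w 6) / (3 / 2),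
    -(17 * w 0 + 4 * w 2) / 9, (675 / 16 * w 5 + 27 / 4 * w 7) / (405 / 16),
    (A + B + C + D) / 4, (A + B - C - D) / 4, (A - B + C - D) / 4, (A - B - C + D) / 4, ?_⟩
  apply eq_zero_of_jet_eq_zero
  · simp only [annX_combination, hX, annX_lump_x, annX_lump_y, annX_evenSol, annX_oddSol,
      annX_expSol hp hq, annX_expSol hp hq', annX_expSol hp' hq, annX_expSol hp' hq', smul_zero,
      add_zero]
  · simp only [annY_combination, hY, annY_lump_x, annY_lump_y, annY_evenSol, annY_oddSol,
      annY_expSol hp hq, annY_expSol hp hq', annY_expSol hp' hq, annY_expSol hp' hq', smul_zero,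
      add_zero]
  · intro i
    change jetZero _ i = 0
    simp only [jetZero_combination, jetZero_lump_x, jetZero_lump_y, jetZero_evenSol,
      jetZero_oddSol, jetZero_expSol hp hq, jetZero_expSol hp hq', jetZero_expSol hp' hq,
      jetZero_expSol hp' hq', ← hw]
    have hB : B * p = (8 / 3 * w 3 + 160 / 9 * w 1) / (3 / 2) := by
      simp only [B]; field_simp
    have hC : C * q = (8 / 9 * w 6 + 32 / 9 * w 4) / (3 / 2) := by
      simp only [C]; field_simp
    have hD : D * (p * q) = (25 * w 7 + 160 * w 5) / (405 / 16) := by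
      simp only [D]; field_simp
    have hA : A = 16 * (7 * w 2 + 32 * w 0) / 81 := rfl
    clear_value A B C D
    fin_cases i <;>
      simp only [Pi.add_apply, Pi.smul_apply, smul_eq_mul, Fin.zero_eta, Fin.mk_one,
        Fin.reduceFinMk, Matrix.cons_val, Matrix.cons_val_zero, Matrix.cons_val_one]
    · linear_combination -9 / 4 * hA
    · linear_combination -47 / 4 * hB
    · linear_combination 153 / 16 * hA
    · linear_combination 3733 / 48 * hB
    · linear_combination -31 / 12 * hC
    · linear_combination -27 / 4 * hD
    · linear_combination 415 / 48 * hC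
    · linear_combination 675 / 16 * hD

/-! ### Asymptotics of the eight solutions along lines. -/

theorem tendsto_ofReal_inv : Tendsto (fun x : ℝ => ((x : ℂ))⁻¹) atTop (𝓝 0) := by
  have := (Complex.continuous_ofReal.tendsto 0).comp tendsto_inv_atTop_zero
  simpa [Function.comp_def] using this

/-- Divided by x², the denominator of `T` tends to a² + b² = 1 + b². Recording the three limits
jointly makes every rational limit below the value of a continuous function at one point. -/
theorem tendsto_T_line {a b : ℝ} (y : ℝ) (ha : a ^ 2 = 1) :
    Tendsto (fun x : ℝ => ((x : ℂ) ^ 2 * (T : ℂ → ℂ) ⟨a * x, y + b * x⟩,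
      (x : ℂ) * (T : ℂ → ℂ) ⟨a * x, y + b * x⟩, (T : ℂ → ℂ) ⟨a * x, y + b * x⟩)) atTop
      (𝓝 ((1 + (b : ℂ) ^ 2)⁻¹, 0, 0)) := by
  have hi := tendsto_ofReal_inv
  have hb : (1 + (b : ℂ) ^ 2) ≠ 0 := by
    have : (0 : ℝ) < 1 + b ^ 2 := by positivity
    exact_mod_cast this.ne'
  have h1 : Tendsto (fun x : ℝ => ((1 + (b : ℂ) ^ 2) + 2 * b * y * (x : ℂ)⁻¹
      + (y ^ 2 + 3) * ((x : ℂ)⁻¹) ^ 2)⁻¹) atTop (𝓝 ((1 + (b : ℂ) ^ 2)⁻¹)) := by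
    refine Tendsto.inv₀ ?_ hb
    have := ((hi.const_mul (2 * b * y : ℂ)).const_add (1 + (b : ℂ) ^ 2)).add
      ((hi.pow 2).const_mul (y ^ 2 + 3 : ℂ))
    simpa using this
  have ha' : (a : ℂ) ^ 2 = 1 := by exact_mod_cast ha
  have h2 : Tendsto (fun x : ℝ => (x : ℂ) ^ 2 * (T : ℂ → ℂ) ⟨a * x, y + b * x⟩) atTop
      (𝓝 ((1 + (b : ℂ) ^ 2)⁻¹)) := by
    refine h1.congr' ?_
    filter_upwards [eventually_gt_atTop 0] with x hx
    have hx' : (x : ℂ) ≠ 0 := by exact_mod_cast hx.ne'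
    have hd := den_ne_zero ⟨a * x, y + b * x⟩
    rw [T_apply]
    push_cast at hd ⊢
    have e : (1 + (b : ℂ) ^ 2) + 2 * b * y * (x : ℂ)⁻¹ + (y ^ 2 + 3) * ((x : ℂ)⁻¹) ^ 2
        = ((a * x : ℂ) ^ 2 + (y + b * x) ^ 2 + 3) * ((x : ℂ) ^ 2)⁻¹ := by
      field_simp
      linear_combination -(x : ℂ) ^ 2 * ha'
    rw [e, mul_inv, inv_inv, mul_comm]
  have h3 : Tendsto (fun x : ℝ => (x : ℂ) * (T : ℂ → ℂ) ⟨a * x, y + b * x⟩) atTop (𝓝 0) := by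
    have := h2.mul hi
    rw [mul_zero] at this
    refine this.congr' ?_
    filter_upwards [eventually_gt_atTop 0] with x hx
    have hx' : (x : ℂ) ≠ 0 := by exact_mod_cast hx.ne'
    field_simp
  have h4 : Tendsto (fun x : ℝ => (T : ℂ → ℂ) ⟨a * x, y + b * x⟩) atTop (𝓝 0) := by
    have := h3.mul hi
    rw [mul_zero] at this
    refine this.congr' ?_
    filter_upwards [eventually_gt_atTop 0] with x hx
    have hx' : (x : ℂ) ≠ 0 := by exact_mod_cast hx.ne'
    field_simp
  exact h2.prodMk_nhds (h3.prodMk_nhds h4)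

theorem tendsto_line_cocompact {a b : ℝ} (y : ℝ) (ha : a ^ 2 = 1) :
    Tendsto (fun x : ℝ => (⟨a * x, y + b * x⟩ : ℂ)) atTop (cocompact ℂ) := by
  rw [← Metric.cobounded_eq_cocompact, ← tendsto_norm_atTop_iff_cobounded]
  refine tendsto_atTop_mono (fun x => ?_) tendsto_id
  refine le_trans ?_ (Complex.abs_re_le_norm _)
  have h1 : |a| = 1 := 
    (sq_eq_sq₀ (abs_nonneg a) zero_le_one).1 (by rw [sq_abs, ha, one_pow])
  simp only [abs_mul, h1, one_mul, id]
  exact le_abs_self x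

/-- A function of the line that is a polynomial in `x² T`, `x T`, `T` and `1 / x`. -/
theorem tendsto_line {a b : ℝ} (y : ℝ) (ha : a ^ 2 = 1) {f : ℝ → ℂ} {F : ℂ × ℂ × ℂ → ℂ}
    (hF : Continuous F) (hf : ∀ x : ℝ, x ≠ 0 → f x = F ((x : ℂ) ^ 2 * (T : ℂ → ℂ) ⟨a * x, y + b * x⟩,
      (x : ℂ) * (T : ℂ → ℂ) ⟨a * x, y + b * x⟩, (T : ℂ → ℂ) ⟨a * x, y + b * x⟩)) :
    Tendsto f atTop (𝓝 (F ((1 + (b : ℂ) ^ 2)⁻¹, 0, 0))) := by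
  refine ((hF.tendsto _).comp (tendsto_T_line (a := a) (b := b) y ha)).congr' ?_
  filter_upwards [eventually_ne_atTop 0] with x hx
  exact (hf x hx).symm

/-- On horizontal lines the only term of order 1/x is -18 p X T. -/
theorem tendsto_expCoeff {a : ℝ} (y : ℝ) (ha : a ^ 2 = 1) (p q : ℂ) :
    Tendsto (fun x : ℝ => (x : ℂ) * (expCoeff00 p q : ℂ → ℂ) ⟨a * x, y⟩) atTop
      (𝓝 (-18 * a * p)) := by
  have ha' : (a : ℂ) ^ 2 = 1 := by exact_mod_cast ha
  have := tendsto_line (a := a) (b := 0) (f := fun x : ℝ =>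
      (x : ℂ) * (expCoeff00 p q : ℂ → ℂ) ⟨a * x, y⟩) y ha
    (F := fun v => 45 * v.2.1 - 216 * v.2.1 * v.2.2 - 36 * y * q * v.2.1
      + 96 * y * q * v.2.1 * v.2.2 - 18 * a * p * v.1 - 288 * a * p * v.1 * v.2.2
      + 192 * a * y * p * q * v.1 * v.2.2 + 72 * a ^ 2 * v.1 * v.2.1
      + 864 * a ^ 2 * v.1 * v.2.1 * v.2.2 - 384 * a ^ 2 * y * q * v.1 * v.2.1 * v.2.2
      - 192 * a ^ 3 * p * v.1 ^ 2 * v.2.2) (by fun_prop) (by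
      intro x hx
      simp only [expCoeff00, add_coe, mul_coe, sub_coe, pow_coe, ofNat_coe, algebraMap_coe,
        X_apply, Y_apply, zero_mul, add_zero]
      push_cast
      ring)
  simpa using this

/-- On the side where the exponential grows, e^{-p₀x} cancels it and the factor x compensates the
1/x decay of the coefficient. What remains is the dependence on y through e^{qy}, which separates
`q` from `-q`. -/
theorem tendsto_exp_expSol {a : ℝ} (y : ℝ) (ha : a ^ 2 = 1) {p₀ : ℝ} {q : ℂ}
    (hp : 4 * (a * p₀ : ℂ) ^ 2 = 3) (hq : 16 * q ^ 2 = -3) :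
    Tendsto (fun x : ℝ => (x : ℂ) * Complex.exp (-(p₀ * x)) *
      (expSol (a * p₀) q : ℂ → ℂ) ⟨a * x, y⟩) atTop
      (𝓝 (Complex.exp (q * y) * (-9 / 2 * p₀))) := by
  have ha' : (a : ℂ) ^ 2 = 1 := by exact_mod_cast ha
  have h := (tendsto_expCoeff y ha (a * p₀) q).const_mul (Complex.exp (q * y) / 4)
  have e : Complex.exp (q * y) * (-9 / 2 * p₀)
      = Complex.exp (q * y) / 4 * (-18 * a * (a * p₀)) := by
    linear_combination 9 / 2 * p₀ * Complex.exp (q * y) * ha'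
  rw [e]
  refine h.congr fun x => ?_
  have h1 := congrFun (congrArg Subtype.val (expSol_eq hp hq)) ⟨a * x, y⟩
  change 4 * (expSol (a * p₀) q : ℂ → ℂ) ⟨a * x, y⟩
    = (expo (a * p₀) q : ℂ → ℂ) ⟨a * x, y⟩ * (expCoeff00 (a * p₀) q : ℂ → ℂ) ⟨a * x, y⟩ at h1
  rw [expo_apply] at h1
  have h2 : (a * p₀ : ℂ) * ((a * x : ℝ) : ℂ) + q * y = p₀ * x + q * y := by
    push_cast
    linear_combination (p₀ : ℂ) * x * ha'
  simp only [h2, Complex.exp_add] at h1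
  have h3 : Complex.exp (-(p₀ * x)) * Complex.exp (p₀ * x) = 1 := by
    rw [← Complex.exp_add]
    simp
  linear_combination -(x : ℂ) * Complex.exp (-(p₀ * x)) / 4 * h1 - x * Complex.exp (q * y)
    * (expCoeff00 (a * p₀) q : ℂ → ℂ) ⟨a * x, y⟩ / 4 * h3

theorem tendsto_pow_mul_exp {p₀ : ℝ} (hp₀ : 0 < p₀) (n : ℕ) :
    Tendsto (fun x : ℝ => (x : ℂ) ^ n * Complex.exp (-(p₀ * x))) atTop (𝓝 0) := by
  have h := Real.tendsto_pow_mul_exp_neg_atTop_nhds_zero n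
  have h1 : Tendsto (fun x : ℝ => x ^ n * Real.exp (-(p₀ * x))) atTop (𝓝 0) := by
    have := (h.comp (tendsto_id.const_mul_atTop hp₀)).const_mul (p₀ ^ n)⁻¹
    rw [mul_zero] at this
    refine this.congr fun x => ?_
    simp only [Function.comp, id, mul_pow]
    field_simp
  have := (Complex.continuous_ofReal.tendsto 0).comp h1
  simpa [Function.comp_def] using this

/-- On the opposite side the two exponentials combine to e^{-2p₀x}. -/
theorem tendsto_exp_expSol_zero {a : ℝ} (y : ℝ) (ha : a ^ 2 = 1) {p₀ : ℝ} (hp₀ : 0 < p₀) {q : ℂ}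
    (hp : 4 * (-(a * p₀) : ℂ) ^ 2 = 3) (hq : 16 * q ^ 2 = -3) :
    Tendsto (fun x : ℝ => (x : ℂ) * Complex.exp (-(p₀ * x)) *
      (expSol (-(a * p₀)) q : ℂ → ℂ) ⟨a * x, y⟩) atTop (𝓝 0) := by
  have ha' : (a : ℂ) ^ 2 = 1 := by exact_mod_cast ha
  have h := ((tendsto_expCoeff y ha (-(a * p₀)) q).const_mul (Complex.exp (q * y) / 4)).mul
    ((tendsto_pow_mul_exp hp₀ 0).pow 2)
  rw [zero_pow two_ne_zero, mul_zero] at h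
  refine h.congr fun x => ?_
  have h1 := congrFun (congrArg Subtype.val (expSol_eq hp hq)) ⟨a * x, y⟩
  change 4 * (expSol (-(a * p₀)) q : ℂ → ℂ) ⟨a * x, y⟩
    = (expo (-(a * p₀)) q : ℂ → ℂ) ⟨a * x, y⟩ * (expCoeff00 (-(a * p₀)) q : ℂ → ℂ) ⟨a * x, y⟩ at h1
  rw [expo_apply] at h1
  have h2 : (-(a * p₀) : ℂ) * ((a * x : ℝ) : ℂ) + q * y = -(p₀ * x) + q * y := by
    push_cast
    linear_combination -(p₀ : ℂ) * x * ha'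
  simp only [h2, Complex.exp_add] at h1
  linear_combination -(x : ℂ) * Complex.exp (-(p₀ * x)) / 4 * h1

theorem tendsto_lump_x {a b : ℝ} (y : ℝ) (ha : a ^ 2 = 1) :
    Tendsto (fun x : ℝ => (dx lumpFun : ℂ → ℂ) ⟨a * x, y + b * x⟩) atTop (𝓝 0) := by
  have := tendsto_line (a := a) (b := b) y ha
    (f := fun x : ℝ => (dx lumpFun : ℂ → ℂ) ⟨a * x, y + b * x⟩)
    (F := fun v => -24 * a * v.2.1 * v.2.2 + 32 * a ^ 3 * v.2.1 ^ 3) (by fun_prop) (by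
      intro x hx
      simp only [lump_x_eq, add_coe, mul_coe, neg_coe, pow_coe, ofNat_coe, X_apply]
      push_cast
      ring)
  simpa using this

theorem tendsto_lump_y {a b : ℝ} (y : ℝ) (ha : a ^ 2 = 1) :
    Tendsto (fun x : ℝ => (dy lumpFun : ℂ → ℂ) ⟨a * x, y + b * x⟩) atTop (𝓝 0) := by
  have := tendsto_line (a := a) (b := b) y ha
    (f := fun x : ℝ => (dy lumpFun : ℂ → ℂ) ⟨a * x, y + b * x⟩)
    (F := fun v => -8 * (y * v.2.2 + b * v.2.1) * v.2.2
      + 32 * a ^ 2 * v.2.1 ^ 2 * (y * v.2.2 + b * v.2.1)) (by fun_prop) (by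
      intro x hx
      simp only [lump_y_eq, add_coe, mul_coe, neg_coe, pow_coe, ofNat_coe, X_apply, Y_apply]
      push_cast
      ring)
  simpa using this

theorem tendsto_evenSol {a b : ℝ} (y : ℝ) (ha : a ^ 2 = 1) :
    Tendsto (fun x : ℝ => (evenSol : ℂ → ℂ) ⟨a * x, y + b * x⟩) atTop (𝓝 1) := by
  have := tendsto_line (a := a) (b := b) y ha
    (f := fun x : ℝ => (evenSol : ℂ → ℂ) ⟨a * x, y + b * x⟩)
    (F := fun v => 1 + 24 * v.2.2 - 120 * a ^ 2 * v.2.1 ^ 2 - 144 * v.2.2 ^ 2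
      + 96 * a ^ 4 * v.1 * v.2.1 ^ 2 + 576 * a ^ 2 * v.2.1 ^ 2 * v.2.2) (by fun_prop) (by
      intro x hx
      simp only [evenSol, add_coe, sub_coe, mul_coe, pow_coe, ofNat_coe, one_coe, X_apply]
      push_cast
      ring)
  simpa using this

theorem tendsto_oddSol {a b : ℝ} (y : ℝ) (ha : a ^ 2 = 1) :
    Tendsto (fun x : ℝ => (oddSol : ℂ → ℂ) ⟨a * x, y + b * x⟩ * (x : ℂ)⁻¹ * (x : ℂ)⁻¹) atTop
      (𝓝 (a * b)) := by
  have h1 := tendsto_line (a := a) (b := b) y ha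
    (f := fun x : ℝ => (1 - 56 * X ^ 2 * T ^ 2 + 32 * X ^ 4 * T ^ 3 - 192 * X ^ 2 * T ^ 3 + 24 * T
      + 144 * T ^ 2 : smoothFunctions).1 ⟨a * x, y + b * x⟩)
    (F := fun v => 1 - 56 * a ^ 2 * v.2.1 ^ 2 + 32 * a ^ 4 * v.1 * v.2.1 ^ 2
      - 192 * a ^ 2 * v.2.1 ^ 2 * v.2.2 + 24 * v.2.2 + 144 * v.2.2 ^ 2) (by fun_prop) (by
      intro x hx
      simp only [add_coe, sub_coe, mul_coe, pow_coe, ofNat_coe, one_coe, X_apply]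
      push_cast
      ring)
  have h2 := ((tendsto_ofReal_inv.const_mul (y : ℂ)).const_add (b : ℂ)).const_mul (a : ℂ)
  have h3 := h2.mul h1
  simp only [mul_zero, add_zero, mul_one, sub_zero, zero_pow two_ne_zero] at h3
  refine h3.congr' ?_
  filter_upwards [eventually_gt_atTop 0] with x hx
  have hx' : (x : ℂ) ≠ 0 := by exact_mod_cast hx.ne'
  rw [oddSol, mul_coe, mul_coe, X_apply, Y_apply]
  push_cast
  field_simp
  ring

/-- A decaying smooth function in the common kernel of `annX` and `annY` is a combination of the
derivatives of the lump. -/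
theorem eq_combination_of_tendsto_zero {u : smoothFunctions} (hX : annX u = 0) (hY : annY u = 0)
    (hu : Tendsto (u : ℂ → ℂ) (cocompact ℂ) (𝓝 0)) :
    ∃ c₁ c₂ : ℂ, u = c₁ • dx lumpFun + c₂ • dy lumpFun := by
  let p₀ : ℝ := √3 / 2
  -- With this choice q² = -p₀²/4 = -3/16.
  let q : ℂ := Complex.I * p₀ / 2
  have hp₀ : 0 < p₀ := by positivity
  have hp₀' : 4 * (p₀ : ℂ) ^ 2 = 3 := by
    have : 4 * p₀ ^ 2 = 3 := by
      simp only [p₀, div_pow, Real.sq_sqrt (show (0 : ℝ) ≤ 3 by norm_num)]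
      norm_num
    exact_mod_cast this
  have hq : 16 * q ^ 2 = -3 := by
    simp only [q, div_pow, mul_pow, Complex.I_sq]
    linear_combination -hp₀'
  have hq' : 16 * (-q) ^ 2 = -3 := by rw [neg_sq, hq]
  obtain ⟨c₁, c₂, c₃, c₄, d₁, d₂, d₃, d₄, h⟩ := exists_combination hp₀' hq hX hY
  have hz : ∀ z : ℂ, (u : ℂ → ℂ) z + c₁ * (dx lumpFun : ℂ → ℂ) z + c₂ * (dy lumpFun : ℂ → ℂ) z
      + c₃ * (evenSol : ℂ → ℂ) z + c₄ * (oddSol : ℂ → ℂ) z + d₁ * (expSol p₀ q : ℂ → ℂ) z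
      + d₂ * (expSol p₀ (-q) : ℂ → ℂ) z + d₃ * (expSol (-p₀) q : ℂ → ℂ) z
      + d₄ * (expSol (-p₀) (-q) : ℂ → ℂ) z = 0 := fun z => congrFun (congrArg Subtype.val h) z
  -- the rational part grows at most quadratically
  have hrat : ∀ (a y : ℝ), a ^ 2 = 1 → Tendsto (fun x : ℝ => (x : ℂ) * Complex.exp (-(p₀ * x)) *
      ((u : ℂ → ℂ) ⟨a * x, y⟩ + c₁ * (dx lumpFun : ℂ → ℂ) ⟨a * x, y⟩
        + c₂ * (dy lumpFun : ℂ → ℂ) ⟨a * x, y⟩ + c₃ * (evenSol : ℂ → ℂ) ⟨a * x, y⟩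
        + c₄ * (oddSol : ℂ → ℂ) ⟨a * x, y⟩)) atTop (𝓝 0) := by
    intro a y ha
    have h1 := (hu.comp (tendsto_line_cocompact (b := 0) y ha)).add
      (((tendsto_lump_x (b := 0) y ha).const_mul c₁).add
      (((tendsto_lump_y (b := 0) y ha).const_mul c₂).add
      ((tendsto_evenSol (b := 0) y ha).const_mul c₃)))
    have h2 := (tendsto_pow_mul_exp hp₀ 1).mul h1
    -- `oddSol` is controlled only after division by x², hence the cube: one factor x comes from the
    -- weight and two make up for the division.
    have h3 := (tendsto_pow_mul_exp hp₀ 3).mul ((tendsto_oddSol (b := 0) y ha).const_mul c₄)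
    have h4 := h2.add h3
    simp only [zero_mul, add_zero, Function.comp_def] at h4
    refine h4.congr' ?_
    filter_upwards [eventually_ne_atTop 0] with x hx
    have hx' : (x : ℂ) ≠ 0 := by exact_mod_cast hx
    field_simp
    ring
  have key : ∀ d e : ℂ, (∀ y : ℝ, d * (Complex.exp (q * y) * (-9 / 2 * p₀))
      + e * (Complex.exp (-q * y) * (-9 / 2 * p₀)) = 0) → d = 0 ∧ e = 0 := by
    intro d e hde
    have hp : (p₀ : ℂ) ≠ 0 := by exact_mod_cast hp₀.ne'
    have h0 : d + e = 0 := by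
      have := hde 0
      simp only [Complex.ofReal_zero, mul_zero, Complex.exp_zero, one_mul] at this
      have h9 : (-9 / 2 * p₀ : ℂ) ≠ 0 := mul_ne_zero (by norm_num) hp
      exact (mul_eq_zero.1 (by rw [add_mul]; exact this)).resolve_right h9
    have h1 : d - e = 0 := by
      -- Here q y = iπ/2, so the two exponentials are i and -i, giving d - e = 0 to complement the
      -- value at y = 0.
      have := hde (Real.pi / p₀)
      have e1 : q * ((Real.pi / p₀ : ℝ) : ℂ) = Real.pi / 2 * Complex.I := by
        simp only [q]
        push_cast
        field_simp
      rw [neg_mul, e1, Complex.exp_neg, Complex.exp_pi_div_two_mul_I, Complex.inv_I] at this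
      have h9 : (Complex.I * (-9 / 2 * p₀) : ℂ) ≠ 0 :=
        mul_ne_zero Complex.I_ne_zero (mul_ne_zero (by norm_num) hp)
      exact (mul_eq_zero.1 (by linear_combination this)).resolve_right h9
    exact ⟨by linear_combination (h0 + h1) / 2, by linear_combination (h0 - h1) / 2⟩
  have hd12 : d₁ = 0 ∧ d₂ = 0 := by
    refine key d₁ d₂ fun y => ?_
    have ha : (1 : ℝ) ^ 2 = 1 := one_pow 2
    have s1 : 4 * ((1 : ℝ) * p₀ : ℂ) ^ 2 = 3 := by simpa using hp₀'
    have s2 : 4 * (-((1 : ℝ) * p₀) : ℂ) ^ 2 = 3 := by simpa using hp₀'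
    have t1 := (tendsto_exp_expSol y ha s1 hq).const_mul d₁
    have t2 := (tendsto_exp_expSol y ha s1 hq').const_mul d₂
    have t3 := (tendsto_exp_expSol_zero y ha hp₀ s2 hq).const_mul d₃
    have t4 := (tendsto_exp_expSol_zero y ha hp₀ s2 hq').const_mul d₄
    have t := (((hrat 1 y ha).add (t1.add t2)).add t3).add t4
    simp only [mul_zero, add_zero, zero_add] at t
    refine tendsto_nhds_unique t (tendsto_const_nhds.congr fun x => ?_)
    have := hz ⟨1 * x, y⟩
    simp only [Complex.ofReal_one, one_mul] at this ⊢
    linear_combination -(x * Complex.exp (-(p₀ * x))) * this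
  -- The same comparison as x → -∞, where the exponentials with exponent `-p₀` are the growing ones.
  have hd34 : d₃ = 0 ∧ d₄ = 0 := by
    refine key d₃ d₄ fun y => ?_
    have ha : (-1 : ℝ) ^ 2 = 1 := by norm_num
    have s1 : 4 * ((-1 : ℝ) * p₀ : ℂ) ^ 2 = 3 := by simpa using hp₀'
    have s2 : 4 * (-((-1 : ℝ) * p₀) : ℂ) ^ 2 = 3 := by simpa using hp₀'
    have t1 := (tendsto_exp_expSol y ha s1 hq).const_mul d₃
    have t2 := (tendsto_exp_expSol y ha s1 hq').const_mul d₄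
    have t3 := (tendsto_exp_expSol_zero y ha hp₀ s2 hq).const_mul d₁
    have t4 := (tendsto_exp_expSol_zero y ha hp₀ s2 hq').const_mul d₂
    have t := (((hrat (-1) y ha).add (t1.add t2)).add t3).add t4
    simp only [mul_zero, add_zero, zero_add] at t
    refine tendsto_nhds_unique t (tendsto_const_nhds.congr fun x => ?_)
    have := hz ⟨-1 * x, y⟩
    simp only [Complex.ofReal_neg, Complex.ofReal_one, neg_mul, one_mul, neg_neg] at this ⊢
    linear_combination -(x * Complex.exp (-(p₀ * x))) * this
  obtain ⟨rfl, rfl⟩ := hd12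
  obtain ⟨rfl, rfl⟩ := hd34
  simp only [zero_mul, add_zero] at hz
  have ha : (1 : ℝ) ^ 2 = 1 := one_pow 2
  have hi := tendsto_ofReal_inv
  -- On the diagonal `oddSol` is asymptotic to x², while all other remaining terms are bounded.
  have hc₄ : c₄ = 0 := by
    have t := ((hu.comp (tendsto_line_cocompact (b := 1) 0 ha)).add
      (((tendsto_lump_x (b := 1) 0 ha).const_mul c₁).add
      (((tendsto_lump_y (b := 1) 0 ha).const_mul c₂).add
      ((tendsto_evenSol (b := 1) 0 ha).const_mul c₃)))).mul (hi.mul hi)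
    have t2 := t.add ((tendsto_oddSol (b := 1) 0 ha).const_mul c₄)
    simp only [mul_zero, Complex.ofReal_one, one_mul, mul_one, zero_add, Function.comp_def] at t2
    refine tendsto_nhds_unique t2 (tendsto_const_nhds.congr fun x => ?_)
    linear_combination -(x : ℂ)⁻¹ * (x : ℂ)⁻¹ * hz ⟨x, x⟩
  subst hc₄
  simp only [zero_mul, add_zero] at hz
  -- With the growing terms gone, only `evenSol` has a nonzero limit along the diagonal.
  have hc₃ : c₃ = 0 := by
    have t := (hu.comp (tendsto_line_cocompact (b := 1) 0 ha)).add
      (((tendsto_lump_x (b := 1) 0 ha).const_mul c₁).add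
      (((tendsto_lump_y (b := 1) 0 ha).const_mul c₂).add
      ((tendsto_evenSol (b := 1) 0 ha).const_mul c₃)))
    simp only [mul_zero, one_mul, mul_one, zero_add, Function.comp_def] at t
    refine tendsto_nhds_unique t (tendsto_const_nhds.congr fun x => ?_)
    linear_combination -hz ⟨x, x⟩
  subst hc₃
  refine ⟨-c₁, -c₂, ?_⟩
  ext z
  change (u : ℂ → ℂ) z = -c₁ * (dx lumpFun : ℂ → ℂ) z + -c₂ * (dy lumpFun : ℂ → ℂ) z
  linear_combination hz z

end smoothFunctions

open scoped SchwartzMap LineDeriv FourierTransform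

/-! ### Density of compactly supported functions in the Schwartz space. -/

section Density

variable {E F : Type*} [NormedAddCommGroup E] [NormedSpace ℝ E] [FiniteDimensional ℝ E]
  [NormedAddCommGroup F] [NormedSpace ℝ F]

/-- The compactly supported functions are dense in the Schwartz space. -/
theorem SchwartzMap.dense_hasCompactSupport :
    Dense {f : 𝓢(E, F) | HasCompactSupport f} := by
  intro f
  let χ : ContDiffBump (0 : E) := ⟨1, 2, one_pos, one_lt_two⟩
  have hχ : ContDiff ℝ ∞ χ := χ.contDiff
  have hχc : HasCompactSupport χ := χ.hasCompactSupport
  have hscale : ∀ n : ℕ, ContDiff ℝ ∞ fun x : E => χ ((n + 1 : ℝ)⁻¹ • x) := fun n =>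
    hχ.comp (contDiff_const_smul _)
  have hcpt : ∀ n : ℕ, HasCompactSupport fun x : E => χ ((n + 1 : ℝ)⁻¹ • x) := fun n =>
    hχc.comp_smul (by positivity)
  let g : ℕ → 𝓢(E, F) := fun n =>
    ((hcpt n).smul_right (f' := f)).toSchwartzMap ((hscale n).smul (f.smooth ⊤))
  have hg : ∀ n x, g n x = χ ((n + 1 : ℝ)⁻¹ • x) • f x := fun n x => rfl
  refine mem_closure_of_tendsto (f := g) (b := atTop) ?_
    (Eventually.of_forall fun n => (hcpt n).smul_right (f' := f))
  rw [(schwartz_withSeminorms ℝ E F).tendsto_nhds]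
  rintro ⟨k, l⟩ ε hε
  -- the derivatives of the cutoffs are uniformly bounded
  have hbd : ∀ i : ℕ, ∃ C, ∀ (n : ℕ) (x : E),
      ‖iteratedFDeriv ℝ i (fun x : E => χ ((n + 1 : ℝ)⁻¹ • x) - 1) x‖ ≤ C := by
    intro i
    have hd : ContDiff ℝ ∞ fun x : E => χ x - 1 := hχ.sub contDiff_const
    have hc : ∃ C, ∀ x, ‖iteratedFDeriv ℝ i (fun x : E => χ x - 1) x‖ ≤ C := by
      -- χ - 1 is not compactly supported, so order zero is bounded by 0 ≤ χ ≤ 1; in positive order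
      -- the constant disappears.
      rcases Nat.eq_zero_or_pos i with rfl | hi
      · refine ⟨1, fun x => ?_⟩
        rw [norm_iteratedFDeriv_zero, Real.norm_eq_abs, abs_le]
        have h0 : 0 ≤ χ x := χ.nonneg
        have h1 : χ x ≤ 1 := χ.le_one
        constructor <;> linarith
      · have e : iteratedFDeriv ℝ i (fun x : E => χ x - 1) =
            iteratedFDeriv ℝ i (fun x : E => χ x) := by
          ext1 x
          have := iteratedFDeriv_sub_apply (𝕜 := ℝ) (i := i) (x := x) (f := fun x : E => χ x)
            (g := fun _ => (1 : ℝ)) (hχ.contDiffAt.of_le (by exact_mod_cast le_top))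
            contDiffAt_const
          change iteratedFDeriv ℝ i ((fun x : E => χ x) - fun _ => (1 : ℝ)) x = _
          rw [this, iteratedFDeriv_const_of_ne hi.ne']
          simp
        rw [e]
        exact (hχc.iteratedFDeriv i).exists_bound_of_continuous
          (hχ.continuous_iteratedFDeriv (by exact_mod_cast le_top))
    obtain ⟨C, hC⟩ := hc
    refine ⟨C, fun n x => ?_⟩
    have hcomp := iteratedFDeriv_comp_const_smul (𝕜 := ℝ) (i := i) ((n + 1 : ℝ)⁻¹)
      (hd.of_le (by exact_mod_cast le_top) : ContDiff ℝ i fun x : E => χ x - 1)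
    rw [hcomp, norm_smul]
    have h1 : ‖((n + 1 : ℝ)⁻¹) ^ i‖ ≤ 1 := by
      rw [norm_pow, Real.norm_of_nonneg (by positivity)]
      exact pow_le_one₀ (by positivity) (inv_le_one_of_one_le₀ (by simp))
    calc _ ≤ 1 * C := mul_le_mul h1 (hC _) (norm_nonneg _) zero_le_one
      _ = C := one_mul C
  choose C hC using hbd
  set M : ℝ := ∑ i ∈ Finset.range (l + 1),
    (l.choose i : ℝ) * |C i| * SchwartzMap.seminorm ℝ (k + 1) (l - i) f with hM
  have hM0 : 0 ≤ M := by positivity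
  have hlim : Tendsto (fun n : ℕ => M * (1 / ((n : ℝ) + 1))) atTop (𝓝 (M * 0)) :=
    tendsto_one_div_add_atTop_nhds_zero_nat.const_mul M
  rw [mul_zero] at hlim
  filter_upwards [hlim.eventually (gt_mem_nhds hε)] with n hn
  refine lt_of_le_of_lt ?_ hn
  refine SchwartzMap.seminorm_le_bound ℝ k l _ (by positivity) fun x => ?_
  have hfun : (⇑(g n - f) : E → F) = fun x => (χ ((n + 1 : ℝ)⁻¹ • x) - 1) • f x := by
    ext x
    rw [_root_.sub_apply, hg, sub_smul, one_smul]
  rw [hfun]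
  -- The error vanishes where the cutoff is 1. Elsewhere ‖x‖ ≥ n + 1, and one extra power of ‖x‖,
  -- absorbed by the seminorm of index k + 1, buys a factor 1/(n + 1).
  by_cases hx : ‖x‖ < n + 1
  · have hev : (fun x => (χ ((n + 1 : ℝ)⁻¹ • x) - 1) • f x) =ᶠ[𝓝 x] fun _ => (0 : F) := by
      filter_upwards [(continuous_norm.tendsto x).eventually (gt_mem_nhds hx)] with y hy
      have : χ ((n + 1 : ℝ)⁻¹ • y) = 1 := by
        refine χ.one_of_mem_closedBall ?_
        rw [mem_closedBall_zero_iff, norm_smul, norm_inv, Real.norm_of_nonneg (by positivity)]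
        change (n + 1 : ℝ)⁻¹ * ‖y‖ ≤ 1
        rw [inv_mul_le_iff₀ (by positivity)]
        linarith
      rw [this, sub_self, zero_smul]
    rw [(hev.iteratedFDeriv ℝ l).eq_of_nhds]
    simp only [iteratedFDeriv_fun_zero, Pi.zero_apply, norm_zero, mul_zero]
    positivity
  · rw [not_lt] at hx
    have hle := norm_iteratedFDeriv_smul_le (𝕜 := ℝ) (n := l) (N := ∞)
      ((hscale n).sub contDiff_const : ContDiff ℝ ∞ fun x : E => χ ((n + 1 : ℝ)⁻¹ • x) - 1)
      (f.smooth ⊤) x (by exact_mod_cast le_top)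
    have hn1 : (0 : ℝ) < n + 1 := by positivity
    have hxk : ‖x‖ ^ k ≤ ‖x‖ ^ (k + 1) * (1 / (n + 1)) := by
      rw [pow_succ, mul_assoc]
      refine le_mul_of_one_le_right (by positivity) ?_
      rw [mul_one_div, le_div_iff₀ hn1, one_mul]
      exact hx
    calc ‖x‖ ^ k * ‖iteratedFDeriv ℝ l (fun x => (χ ((n + 1 : ℝ)⁻¹ • x) - 1) • f x) x‖
        ≤ (‖x‖ ^ (k + 1) * (1 / (n + 1))) * ∑ i ∈ Finset.range (l + 1), (l.choose i : ℝ) *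
          ‖iteratedFDeriv ℝ i (fun x : E => χ ((n + 1 : ℝ)⁻¹ • x) - 1) x‖ *
          ‖iteratedFDeriv ℝ (l - i) f x‖ :=
          mul_le_mul hxk hle (norm_nonneg _) (by positivity)
      _ = (∑ i ∈ Finset.range (l + 1), (l.choose i : ℝ) *
          ‖iteratedFDeriv ℝ i (fun x : E => χ ((n + 1 : ℝ)⁻¹ • x) - 1) x‖ *
          (‖x‖ ^ (k + 1) * ‖iteratedFDeriv ℝ (l - i) f x‖)) * (1 / (n + 1)) := by
          rw [Finset.mul_sum, Finset.sum_mul]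
          refine Finset.sum_congr rfl fun i _ => by ring
      _ ≤ M * (1 / (n + 1)) := by
          refine mul_le_mul_of_nonneg_right ?_ (by positivity)
          refine Finset.sum_le_sum fun i _ => ?_
          refine mul_le_mul ?_ (SchwartzMap.le_seminorm ℝ (k + 1) (l - i) f x) (by positivity)
            (by positivity)
          exact mul_le_mul_of_nonneg_left ((hC i n x).trans (le_abs_self _)) (by positivity)

end Density

open MeasureTheory

namespace smoothFunctions

/-! ### Formal adjoints by integration by parts. -/

section FormalAdjoint

theorem hasCompactSupport_dir {f : smoothFunctions} (hf : HasCompactSupport (f : ℂ → ℂ)) (v : ℂ) :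
    HasCompactSupport (dir v f : ℂ → ℂ) := hf.fderiv_apply ℝ v

theorem integrable_mul {f : smoothFunctions} (hf : HasCompactSupport (f : ℂ → ℂ))
    (g : smoothFunctions) : Integrable fun z => (f : ℂ → ℂ) z * (g : ℂ → ℂ) z :=
  ((continuous_coe f).mul (continuous_coe g)).integrable_of_hasCompactSupport hf.mul_right

/-- `B` is a formal adjoint of `A` for the bilinear pairing `∫ f g` with compactly supported `f`. -/
def IsFormalAdjoint (A B : smoothFunctions → smoothFunctions) : Prop :=
  ∀ f : smoothFunctions, HasCompactSupport (f : ℂ → ℂ) → HasCompactSupport (A f : ℂ → ℂ) ∧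
    ∀ g : smoothFunctions, ∫ z, (A f : ℂ → ℂ) z * (g : ℂ → ℂ) z =
      ∫ z, (f : ℂ → ℂ) z * (B g : ℂ → ℂ) z

namespace IsFormalAdjoint

variable {A B A' B' : smoothFunctions → smoothFunctions}

theorem dir (v : ℂ) : IsFormalAdjoint (dir v) (fun g => -smoothFunctions.dir v g) := by
  refine fun f hf => ⟨hasCompactSupport_dir hf v, fun g => ?_⟩
  have := integral_mul_fderiv_eq_neg_fderiv_mul_of_integrable (μ := volume) (𝕜 := ℂ)
    (f := (f : ℂ → ℂ)) (g := (g : ℂ → ℂ)) (v := v)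
    (integrable_mul (hasCompactSupport_dir hf v) g) (integrable_mul hf (smoothFunctions.dir v g))
    (integrable_mul hf g) (fun x _ => differentiable_coe f x) (fun x _ => differentiable_coe g x)
  simp only [neg_coe, mul_neg, integral_neg, dir_apply] at *
  rw [this, neg_neg]

theorem mul (c : smoothFunctions) : IsFormalAdjoint (fun f => c * f) (fun g => c * g) := by
  refine fun f hf => ⟨hf.mul_left, fun g => integral_congr_ae (ae_of_all _ fun z => ?_)⟩
  simp only [mul_coe]
  ring

theorem comp (h : IsFormalAdjoint A B) (h' : IsFormalAdjoint A' B') :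
    IsFormalAdjoint (fun f => A (A' f)) (fun g => B' (B g)) := fun f hf =>
  ⟨(h _ (h' f hf).1).1, fun g => by rw [(h _ (h' f hf).1).2, (h' f hf).2]⟩

theorem add (h : IsFormalAdjoint A B) (h' : IsFormalAdjoint A' B') :
    IsFormalAdjoint (fun f => A f + A' f) (fun g => B g + B' g) := by
  refine fun f hf => ⟨(h f hf).1.add (h' f hf).1, fun g => ?_⟩
  simp only [add_coe, add_mul, mul_add]
  rw [integral_add (integrable_mul (h f hf).1 g) (integrable_mul (h' f hf).1 g),
    integral_add (integrable_mul hf _) (integrable_mul hf _), (h f hf).2, (h' f hf).2]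

theorem neg (h : IsFormalAdjoint A B) : IsFormalAdjoint (fun f => -A f) (fun g => -B g) := by
  refine fun f hf => ⟨(h f hf).1.neg, fun g => ?_⟩
  simp only [neg_coe, neg_mul, mul_neg, integral_neg, (h f hf).2]

theorem sub (h : IsFormalAdjoint A B) (h' : IsFormalAdjoint A' B') :
    IsFormalAdjoint (fun f => A f - A' f) (fun g => B g - B' g) := by
  simpa only [sub_eq_add_neg] using h.add h'.neg

theorem congr (h : IsFormalAdjoint A B) (hA : ∀ f, A f = A' f) (hB : ∀ g, B g = B' g) :
    IsFormalAdjoint A' B' := by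
  obtain rfl : A = A' := funext hA
  obtain rfl : B = B' := funext hB
  exact h

end IsFormalAdjoint

theorem isFormalAdjoint_linOp : IsFormalAdjoint linOpAdj linOp := by
  have hx : IsFormalAdjoint dx _ := .dir 1
  have hy : IsFormalAdjoint dy _ := .dir Complex.I
  have hxx := hx.comp hx
  refine ((((hxx.comp hxx).sub hxx).sub (hy.comp hy)).add
    ((IsFormalAdjoint.mul (6 * lumpFun)).comp hxx)).congr (fun f => rfl) fun g => ?_
  change - dx (-dx (-dx (-dx g))) - -dx (-dx g) - -dy (-dy g) + -dx (-dx (6 * lumpFun * g)) = _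
  simp only [map_neg, neg_neg, linOp, map_add, map_sub]
  ring

/-- The transpose is assembled term by term and then identified through `annX_eq_adjoint`. -/
theorem isFormalAdjoint_annX : IsFormalAdjoint intertwiner' annX := by
  have hx : IsFormalAdjoint dx _ := .dir 1
  have hy : IsFormalAdjoint dy _ := .dir Complex.I
  have hxx := hx.comp hx
  have hm := IsFormalAdjoint.mul
  refine ((((((((hm 4).comp (hxx.comp hxx)).sub ((hm 3).comp hxx)).add
    ((hm 36).comp ((hm T).comp hxx))).add ((hm 12).comp ((hm (X * T)).comp hx))).sub
    ((hm 12).comp ((hm (Y * T)).comp hy))).sub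
    ((hm 24).comp ((hm (X * T)).comp (hx.comp hxx)))).add (hm correction)).congr
    (fun f => rfl) fun g => ?_
  rw [← annX_eq_adjoint]
  change - dx (-dx (-dx (-dx (4 * g)))) - -dx (-dx (3 * g)) + -dx (-dx (T * (36 * g)))
    + -dx (X * T * (12 * g)) - -dy (Y * T * (12 * g)) - -dx (-dx (-dx (X * T * (24 * g))))
    + correction * g = _
  have e (n : ℕ) [n.AtLeastTwo] (a b : smoothFunctions) :
      a * (ofNat(n) * b) = ofNat(n) * (a * b) := by ring
  have e' (D : Derivation ℂ smoothFunctions smoothFunctions) (n : ℕ) [n.AtLeastTwo]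
      (b : smoothFunctions) : D (ofNat(n) * b) = ofNat(n) * D b := by
    simp
  simp only [map_neg, neg_neg, e, e']
  ring

end FormalAdjoint

/-! ### Temperate growth of the coefficients. -/

section Temperate

theorem hasTemperateGrowth_X : (X : ℂ → ℂ).HasTemperateGrowth := by
  change Function.HasTemperateGrowth fun z : ℂ => ((Complex.reCLM z : ℝ) : ℂ)
  fun_prop

theorem hasTemperateGrowth_Y : (Y : ℂ → ℂ).HasTemperateGrowth := by
  change Function.HasTemperateGrowth fun z : ℂ => ((Complex.imCLM z : ℝ) : ℂ)
  fun_prop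

/-- `T` is one third of (1 + |z/√3|²)⁻¹, a rescaling of a standard weight of temperate growth. -/
theorem hasTemperateGrowth_T : (T : ℂ → ℂ).HasTemperateGrowth := by
  have h := (Function.hasTemperateGrowth_one_add_norm_sq_rpow ℂ (-1)).comp
    (g := fun w : ℂ => (1 + ‖w‖ ^ 2) ^ (-1 : ℝ)) (f := fun z : ℂ => (√3)⁻¹ • z) (by fun_prop)
  have e : (T : ℂ → ℂ) = fun z => (3 : ℂ)⁻¹ *
      (((1 + ‖(√3)⁻¹ • z‖ ^ 2) ^ (-1 : ℝ) : ℝ) : ℂ) := by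
    ext z
    rw [T_apply, Real.rpow_neg_one, norm_smul, mul_pow, norm_inv, inv_pow, Real.norm_eq_abs,
      sq_abs, Real.sq_sqrt (by norm_num), Complex.sq_norm, Complex.normSq_apply]
    push_cast
    rw [← mul_inv]
    congr 1
    ring
  rw [e]
  have h' : Function.HasTemperateGrowth fun z : ℂ => (1 + ‖(√3)⁻¹ • z‖ ^ 2) ^ (-1 : ℝ) := h
  fun_prop

theorem hasTemperateGrowth_mul {f g : smoothFunctions} (hf : (f : ℂ → ℂ).HasTemperateGrowth)
    (hg : (g : ℂ → ℂ).HasTemperateGrowth) :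
    ((f * g : smoothFunctions) : ℂ → ℂ).HasTemperateGrowth := hf.mul hg

theorem hasTemperateGrowth_correction : (correction : ℂ → ℂ).HasTemperateGrowth := by
  have hX := hasTemperateGrowth_X
  have hT := hasTemperateGrowth_T
  have e : (correction : ℂ → ℂ) = fun z => 24 * (T : ℂ → ℂ) z
      - 48 * (X : ℂ → ℂ) z ^ 2 * (T : ℂ → ℂ) z ^ 2 - 144 * (T : ℂ → ℂ) z ^ 2 := rfl
  rw [e]
  fun_prop

theorem hasTemperateGrowth_lumpFun : (lumpFun : ℂ → ℂ).HasTemperateGrowth := by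
  have hX := hasTemperateGrowth_X
  have hY := hasTemperateGrowth_Y
  have hT := hasTemperateGrowth_T
  have e : (lumpFun : ℂ → ℂ) = fun z => 4 * ((Y : ℂ → ℂ) z ^ 2 - (X : ℂ → ℂ) z ^ 2 + 3)
      * (T : ℂ → ℂ) z ^ 2 := rfl
  rw [e]
  fun_prop

end Temperate

/-! ### The operators on Schwartz functions. -/

section Schwartz

/-- A Schwartz function as an element of the algebra of smooth functions. -/
noncomputable def ofSchwartz : 𝓢(ℂ, ℂ) →ₗ[ℂ] smoothFunctions where
  toFun f := ⟨f, f.smooth ⊤⟩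
  map_add' _ _ := rfl
  map_smul' _ _ := rfl

theorem ofSchwartz_apply (f : 𝓢(ℂ, ℂ)) (z : ℂ) : (ofSchwartz f : ℂ → ℂ) z = f z := rfl

theorem ofSchwartz_injective : Function.Injective ofSchwartz := fun f g h => by
  ext z
  rw [← ofSchwartz_apply, h, ofSchwartz_apply]

/-- The directional derivative of Schwartz functions. -/
noncomputable def schwartzDir (v : ℂ) : 𝓢(ℂ, ℂ) →L[ℂ] 𝓢(ℂ, ℂ) := LineDeriv.lineDerivOpCLM ℂ 𝓢(ℂ, ℂ) v

/-- The multiplication of Schwartz functions by a function of temperate growth. -/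
noncomputable def schwartzMul (c : smoothFunctions) : 𝓢(ℂ, ℂ) →L[ℂ] 𝓢(ℂ, ℂ) :=
  SchwartzMap.smulLeftCLM ℂ (c : ℂ → ℂ)

theorem ofSchwartz_schwartzDir (v : ℂ) (f : 𝓢(ℂ, ℂ)) :
    ofSchwartz (schwartzDir v f) = dir v (ofSchwartz f) := rfl

theorem ofSchwartz_schwartzMul {c : smoothFunctions} (hc : (c : ℂ → ℂ).HasTemperateGrowth)
    (f : 𝓢(ℂ, ℂ)) : ofSchwartz (schwartzMul c f) = c * ofSchwartz f := by
  ext z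
  exact SchwartzMap.smulLeftCLM_apply_apply hc f z

/-- The free operator on Schwartz functions. -/
noncomputable def schwartzFreeOp : 𝓢(ℂ, ℂ) →L[ℂ] 𝓢(ℂ, ℂ) :=
  schwartzDir 1 ∘L schwartzDir 1 ∘L schwartzDir 1 ∘L schwartzDir 1 - schwartzDir 1 ∘L schwartzDir 1
    - schwartzDir Complex.I ∘L schwartzDir Complex.I

/-- The formal adjoint of the linearized operator on Schwartz functions. -/
noncomputable def schwartzLinOpAdj : 𝓢(ℂ, ℂ) →L[ℂ] 𝓢(ℂ, ℂ) :=
  schwartzFreeOp + (6 : ℂ) • schwartzMul lumpFun ∘L schwartzDir 1 ∘L schwartzDir 1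

/-- The first operator of the intertwining relation on Schwartz functions. -/
noncomputable def schwartzIntertwiner : 𝓢(ℂ, ℂ) →L[ℂ] 𝓢(ℂ, ℂ) :=
  (4 : ℂ) • schwartzDir 1 ∘L schwartzDir 1 ∘L schwartzDir 1 ∘L schwartzDir 1
    - (3 : ℂ) • schwartzDir 1 ∘L schwartzDir 1
    + (36 : ℂ) • schwartzMul T ∘L schwartzDir 1 ∘L schwartzDir 1
    + (12 : ℂ) • schwartzMul (X * T) ∘L schwartzDir 1
    - (12 : ℂ) • schwartzMul (Y * T) ∘L schwartzDir Complex.I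
    - (24 : ℂ) • schwartzMul (X * T) ∘L schwartzDir 1 ∘L schwartzDir 1 ∘L schwartzDir 1

/-- The second operator of the intertwining relation on Schwartz functions. -/
noncomputable def schwartzIntertwiner' : 𝓢(ℂ, ℂ) →L[ℂ] 𝓢(ℂ, ℂ) :=
  schwartzIntertwiner + schwartzMul correction

theorem ofNat_smul_eq_mul (n : ℕ) [n.AtLeastTwo] (f : smoothFunctions) :
    (ofNat(n) : ℂ) • f = ofNat(n) * f := by
  rw [Algebra.smul_def, map_ofNat]

theorem ofSchwartz_schwartzFreeOp (f : 𝓢(ℂ, ℂ)) :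
    ofSchwartz (schwartzFreeOp f) = freeOp (ofSchwartz f) := rfl

theorem ofSchwartz_schwartzLinOpAdj (f : 𝓢(ℂ, ℂ)) :
    ofSchwartz (schwartzLinOpAdj f) = linOpAdj (ofSchwartz f) := by
  have h : schwartzLinOpAdj f = schwartzFreeOp f
    + (6 : ℂ) • schwartzMul lumpFun (schwartzDir 1 (schwartzDir 1 f)) := rfl
  rw [h, map_add, map_smul, ofSchwartz_schwartzMul hasTemperateGrowth_lumpFun,
    ofSchwartz_schwartzFreeOp, ofNat_smul_eq_mul, ofSchwartz_schwartzDir, ofSchwartz_schwartzDir,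
    linOpAdj, mul_assoc]

theorem schwartzIntertwiner_apply (f : 𝓢(ℂ, ℂ)) : schwartzIntertwiner f =
    (4 : ℂ) • schwartzDir 1 (schwartzDir 1 (schwartzDir 1 (schwartzDir 1 f)))
    - (3 : ℂ) • schwartzDir 1 (schwartzDir 1 f)
    + (36 : ℂ) • schwartzMul T (schwartzDir 1 (schwartzDir 1 f))
    + (12 : ℂ) • schwartzMul (X * T) (schwartzDir 1 f)
    - (12 : ℂ) • schwartzMul (Y * T) (schwartzDir Complex.I f)
    - (24 : ℂ) • schwartzMul (X * T) (schwartzDir 1 (schwartzDir 1 (schwartzDir 1 f))) := rfl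

theorem ofSchwartz_schwartzIntertwiner (f : 𝓢(ℂ, ℂ)) :
    ofSchwartz (schwartzIntertwiner f) = intertwiner (ofSchwartz f) := by
  have hXT := hasTemperateGrowth_mul hasTemperateGrowth_X hasTemperateGrowth_T
  have hYT := hasTemperateGrowth_mul hasTemperateGrowth_Y hasTemperateGrowth_T
  simp only [schwartzIntertwiner_apply, map_add, map_sub, map_smul, ofNat_smul_eq_mul,
    ofSchwartz_schwartzMul hasTemperateGrowth_T, ofSchwartz_schwartzMul hXT,
    ofSchwartz_schwartzMul hYT, ofSchwartz_schwartzDir]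
  rfl

theorem ofSchwartz_schwartzIntertwiner' (f : 𝓢(ℂ, ℂ)) :
    ofSchwartz (schwartzIntertwiner' f) = intertwiner' (ofSchwartz f) := by
  have h : schwartzIntertwiner' f = schwartzIntertwiner f + schwartzMul correction f := rfl
  rw [h, map_add, ofSchwartz_schwartzIntertwiner,
    ofSchwartz_schwartzMul hasTemperateGrowth_correction, intertwiner']

/-- The Schwartz version is needed because inverting L₀ by Fourier transform leaves the class of
compactly supported functions. -/
theorem schwartzLinOpAdj_schwartzIntertwiner (f : 𝓢(ℂ, ℂ)) :
    schwartzLinOpAdj (schwartzIntertwiner f) = schwartzIntertwiner' (schwartzFreeOp f) := by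
  apply ofSchwartz_injective
  rw [ofSchwartz_schwartzLinOpAdj, ofSchwartz_schwartzIntertwiner, linOpAdj_intertwiner,
    ofSchwartz_schwartzIntertwiner', ofSchwartz_schwartzFreeOp]

theorem exists_ofSchwartz_eq {f : smoothFunctions} (hf : HasCompactSupport (f : ℂ → ℂ)) :
    ∃ g : 𝓢(ℂ, ℂ), ofSchwartz g = f :=
  ⟨hf.toSchwartzMap (contDiff_coe f), rfl⟩

/-- The distribution given by a bounded continuous function. -/
theorem exists_pairing {Ψ : ℂ → ℂ} (hΨ : Continuous Ψ) {C : ℝ} (hC : ∀ z, ‖Ψ z‖ ≤ C) :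
    ∃ S : 𝓢(ℂ, ℂ) →L[ℂ] ℂ, ∀ f, S f = ∫ z, f z * Ψ z := by
  have hmem : MemLp Ψ ⊤ (volume : Measure ℂ) :=
    memLp_top_of_bound hΨ.aestronglyMeasurable C (ae_of_all _ hC)
  have : Fact ((1 : ENNReal) ≤ ⊤) := ⟨le_top⟩
  let S := Lp.toTemperedDistribution (hmem.toLp Ψ)
  refine ⟨⟨⟨⟨S, map_add S⟩, map_smul S⟩, map_continuous S⟩, fun f => ?_⟩
  change S f = _
  rw [Lp.toTemperedDistribution_apply]
  refine integral_congr_ae ?_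
  filter_upwards [hmem.coeFn_toLp] with z hz
  rw [hz, smul_eq_mul]

end Schwartz

/-! ### Low-frequency averaging and functionals annihilating the range of the free operator. -/

/-- The symbol of the free operator. -/
noncomputable def freeSymbol (ξ : ℂ) : ℝ :=
  (2 * Real.pi) ^ 4 * ξ.re ^ 4 + (2 * Real.pi) ^ 2 * (ξ.re ^ 2 + ξ.im ^ 2)

theorem freeSymbol_pos {ξ : ℂ} (hξ : ξ ≠ 0) : 0 < freeSymbol ξ := by
  have h : 0 < ξ.re ^ 2 + ξ.im ^ 2 := by
    have := Complex.normSq_pos.2 hξ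
    rw [Complex.normSq_apply] at this
    nlinarith
  unfold freeSymbol
  positivity

theorem contDiff_freeSymbol : ContDiff ℝ ∞ freeSymbol := by
  have hre : ContDiff ℝ ∞ fun ξ : ℂ => ξ.re := Complex.reCLM.contDiff
  have him : ContDiff ℝ ∞ fun ξ : ℂ => ξ.im := Complex.imCLM.contDiff
  unfold freeSymbol
  fun_prop

theorem fourier_schwartzDir (v : ℂ) (f : 𝓢(ℂ, ℂ)) (ξ : ℂ) :
    (𝓕 (schwartzDir v f)) ξ = 2 * Real.pi * Complex.I * (inner ℝ ξ v : ℝ) * (𝓕 f) ξ := by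
  have h : schwartzDir v f = ∂_{v} f := rfl
  rw [h, SchwartzMap.fourier_lineDerivOp_eq, smul_apply,
    SchwartzMap.smulLeftCLM_apply_apply (by fun_prop), smul_eq_mul, Complex.real_smul]
  ring

theorem fourier_schwartzFreeOp (f : 𝓢(ℂ, ℂ)) (ξ : ℂ) :
    (𝓕 (schwartzFreeOp f)) ξ = (freeSymbol ξ : ℂ) * (𝓕 f) ξ := by
  have h : schwartzFreeOp f = schwartzDir 1 (schwartzDir 1 (schwartzDir 1 (schwartzDir 1 f)))
    - schwartzDir 1 (schwartzDir 1 f) - schwartzDir Complex.I (schwartzDir Complex.I f) := rfl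
  have h1 : inner ℝ ξ (1 : ℂ) = ξ.re := by simp [Complex.inner]
  have h2 : inner ℝ ξ Complex.I = ξ.im := by simp [Complex.inner]
  have hsub (f g : 𝓢(ℂ, ℂ)) : 𝓕 (f - g) = 𝓕 f - 𝓕 g :=
    map_sub (FourierTransform.fourierCLE ℂ 𝓢(ℂ, ℂ)) f g
  rw [h, hsub, hsub, sub_apply, sub_apply]
  simp only [fourier_schwartzDir, h1, h2, freeSymbol]
  have hI : Complex.I ^ 2 = -1 := Complex.I_sq
  have hI4 : Complex.I ^ 4 = 1 := Complex.I_pow_four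
  push_cast
  linear_combination (2 * Real.pi) ^ 4 * (ξ.re : ℂ) ^ 4 * (𝓕 f) ξ * hI4
    - (2 * Real.pi) ^ 2 * ((ξ.re : ℂ) ^ 2 + (ξ.im : ℂ) ^ 2) * (𝓕 f) ξ * hI

/-- A radial cutoff. -/
noncomputable def cutoff : ContDiffBump (0 : ℂ) := ⟨1, 2, one_pos, one_lt_two⟩

theorem contDiff_cutoff_smul (r : ℝ) : ContDiff ℝ ∞ fun ξ : ℂ => ((cutoff (r • ξ) : ℝ) : ℂ) :=
  Complex.ofRealCLM.contDiff.comp (cutoff.contDiff.comp (contDiff_const_smul r))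

theorem hasCompactSupport_cutoff_smul {r : ℝ} (hr : r ≠ 0) :
    HasCompactSupport fun ξ : ℂ => ((cutoff (r • ξ) : ℝ) : ℂ) :=
  (cutoff.hasCompactSupport.comp_smul hr).comp_left (g := fun x : ℝ => (x : ℂ)) (by simp)

/-- The dilated cutoff as a Schwartz function. -/
noncomputable def schwartzCutoff (n : ℕ) : 𝓢(ℂ, ℂ) :=
  (hasCompactSupport_cutoff_smul (Nat.cast_add_one_ne_zero n)).toSchwartzMap
    (contDiff_cutoff_smul ((n : ℝ) + 1))

theorem schwartzCutoff_apply (n : ℕ) (ξ : ℂ) :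
    schwartzCutoff n ξ = ((cutoff (((n : ℝ) + 1) • ξ) : ℝ) : ℂ) := rfl

/-- The averaging kernel at scale `n + 1`. -/
noncomputable def kernel (n : ℕ) : 𝓢(ℂ, ℂ) := 𝓕⁻ (schwartzCutoff n)

/-- The change of variables ξ ↦ (n + 1)ξ: localizing to frequencies of size 1/(n + 1) spreads the
kernel over scale n + 1. The square is the real dimension of ℂ. -/
theorem kernel_apply (n : ℕ) (z : ℂ) :
    kernel n z = (((n : ℝ) + 1) ^ 2)⁻¹ • kernel 0 (((n : ℝ) + 1)⁻¹ • z) := by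
  have hn : (n : ℝ) + 1 ≠ 0 := Nat.cast_add_one_ne_zero n
  rw [kernel, kernel, SchwartzMap.fourierInv_coe, SchwartzMap.fourierInv_coe, Real.fourierInv_eq,
    Real.fourierInv_eq]
  have := Measure.integral_comp_smul (volume : Measure ℂ)
    (fun ξ => Real.fourierChar (inner ℝ ξ (((n : ℝ) + 1)⁻¹ • z)) • schwartzCutoff 0 ξ) ((n : ℝ) + 1)
  rw [Complex.finrank_real_complex, abs_of_nonneg (by positivity)] at this
  rw [← this]
  refine integral_congr_ae (ae_of_all _ fun ξ => ?_)
  simp only [schwartzCutoff_apply, real_inner_smul_left, real_inner_smul_right, Nat.cast_zero,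
    zero_add, one_smul]
  rw [inv_mul_cancel_left₀ hn]

/-- The averaging operator at scale `n + 1`. -/
noncomputable def average (n : ℕ) : 𝓢(ℂ, ℂ) →L[ℂ] 𝓢(ℂ, ℂ) :=
  SchwartzMap.convolution (ContinuousLinearMap.mul ℂ ℂ) (kernel n)

theorem average_apply (n : ℕ) (f : 𝓢(ℂ, ℂ)) (z : ℂ) :
    average n f z = ∫ t, kernel n t * f (z - t) := by
  rw [average, SchwartzMap.convolution_apply]
  rfl

theorem fourier_average (n : ℕ) (f : 𝓢(ℂ, ℂ)) (ξ : ℂ) :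
    (𝓕 (average n f)) ξ = ((cutoff (((n : ℝ) + 1) • ξ) : ℝ) : ℂ) * (𝓕 f) ξ := by
  rw [average, SchwartzMap.fourier_convolution]
  have : 𝓕 (kernel n) = schwartzCutoff n := FourierTransform.fourier_fourierInv_eq _
  rw [this]
  rfl

theorem average_schwartzDir (n : ℕ) (v : ℂ) (f : 𝓢(ℂ, ℂ)) :
    average n (schwartzDir v f) = schwartzDir v (average n f) := by
  apply (FourierTransform.fourierCLE ℂ 𝓢(ℂ, ℂ)).injective
  ext ξ
  simp only [FourierTransform.fourierCLE_apply, fourier_average, fourier_schwartzDir]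
  ring

/-- A functional vanishes under averaging when it tends to zero along the averages of every
Schwartz function. -/
def VanishesUnderAveraging (S : 𝓢(ℂ, ℂ) →L[ℂ] ℂ) : Prop :=
  ∀ f, Tendsto (fun n => S (average n f)) atTop (𝓝 0)

namespace VanishesUnderAveraging

variable {S S' : 𝓢(ℂ, ℂ) →L[ℂ] ℂ}

theorem add (h : VanishesUnderAveraging S) (h' : VanishesUnderAveraging S') :
    VanishesUnderAveraging (S + S') := fun f => by simpa using (h f).add (h' f)

theorem sub (h : VanishesUnderAveraging S) (h' : VanishesUnderAveraging S') :
    VanishesUnderAveraging (S - S') := fun f => by simpa using (h f).sub (h' f)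

theorem smul (c : ℂ) (h : VanishesUnderAveraging S) :
    VanishesUnderAveraging (c • S) := fun f => by simpa using (h f).const_mul c

theorem comp_schwartzDir (h : VanishesUnderAveraging S) (v : ℂ) :
    VanishesUnderAveraging (S ∘L schwartzDir v) := fun f => by
  simpa [average_schwartzDir] using h (schwartzDir v f)

/-- The average of `f` spreads out at scale n + 1, so its pairing with a function vanishing at
infinity tends to zero. -/
theorem of_pairing {Ψ : ℂ → ℂ} (hΨ : Continuous Ψ) (h0 : Tendsto Ψ (cocompact ℂ) (𝓝 0))
    (hS : ∀ f, S f = ∫ z, f z * Ψ z) : VanishesUnderAveraging S := by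
  intro f
  obtain ⟨C, hC⟩ : ∃ C, ∀ z, ‖Ψ z‖ ≤ C := by
    let Ψ₀ : ZeroAtInftyContinuousMap ℂ ℂ := ⟨⟨Ψ, hΨ⟩, h0⟩
    exact ⟨‖Ψ₀.toBCF‖, fun z => Ψ₀.toBCF.norm_coe_le_norm z⟩
  have hC0 : 0 ≤ C := (norm_nonneg _).trans (hC 0)
  set H : ℂ → ℂ := fun t => ∫ y, f y * Ψ (y + t) with hH
  have hmeas : ∀ t, AEStronglyMeasurable (fun y => f y * Ψ (y + t)) volume := fun t =>
    (f.continuous.mul (hΨ.comp (continuous_add_const t))).aestronglyMeasurable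
  have hbound : ∀ t, ∀ᵐ y, ‖f y * Ψ (y + t)‖ ≤ ‖f y‖ * C := fun t => ae_of_all _ fun y => by
    rw [norm_mul]
    exact mul_le_mul_of_nonneg_left (hC _) (norm_nonneg _)
  have hint : Integrable (fun y => ‖f y‖ * C) := f.integrable.norm.mul_const C
  have hHc : Continuous H := continuous_of_dominated hmeas hbound hint <| ae_of_all _ fun y =>
    continuous_const.mul (hΨ.comp (continuous_const_add y))
  have hHb : ∀ t, ‖H t‖ ≤ ∫ y, ‖f y‖ * C := fun t => norm_integral_le_of_norm_le hint (hbound t)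
  have : (cocompact ℂ).IsCountablyGenerated := by
    rw [← Metric.cobounded_eq_cocompact, ← comap_norm_atTop]
    infer_instance
  have hH0 : Tendsto H (cocompact ℂ) (𝓝 0) := by
    have : Tendsto H (cocompact ℂ) (𝓝 (∫ y, f y * 0)) := by
      refine tendsto_integral_filter_of_dominated_convergence _ (Eventually.of_forall hmeas)
        (Eventually.of_forall hbound) hint (ae_of_all _ fun y => ?_)
      exact (h0.comp (Homeomorph.addLeft y).isClosedEmbedding.tendsto_cocompact).const_mul _
    simpa using this
  -- Fubini and rescaling put all dependence on `n` into the argument of `H`, the correlation of `f`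
  -- with `Ψ`, which is bounded and tends to zero at infinity.
  have hS' : ∀ n, S (average n f) = ∫ u, kernel 0 u * H (((n : ℝ) + 1) • u) := by
    intro n
    have hn : (n : ℝ) + 1 ≠ 0 := Nat.cast_add_one_ne_zero n
    have hprod : Integrable (fun p : ℂ × ℂ => kernel n p.2 * f (p.1 - p.2) * Ψ p.1)
        (volume.prod volume) := by
      refine Integrable.mul_bdd (c := C) ?_ ?_ ?_
      · exact Integrable.convolution_integrand (ContinuousLinearMap.mul ℂ ℂ) (kernel n).integrable
          f.integrable
      · exact (hΨ.comp continuous_fst).aestronglyMeasurable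
      · exact ae_of_all _ fun p => hC p.1
    calc S (average n f) = ∫ z, ∫ t, kernel n t * f (z - t) * Ψ z := by
          rw [hS]
          refine integral_congr_ae (ae_of_all _ fun z => ?_)
          simp only [average_apply]
          rw [integral_mul_const]
      _ = ∫ t, ∫ z, kernel n t * f (z - t) * Ψ z := integral_integral_swap hprod
      _ = ∫ t, kernel n t * H t := by
          refine integral_congr_ae (ae_of_all _ fun t => ?_)
          simp only [mul_assoc]
          rw [integral_const_mul, hH]
          congr 1
          rw [← integral_add_right_eq_self (fun z => f (z - t) * Ψ z) t]
          simp only [add_sub_cancel_right]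
      _ = ∫ u, kernel 0 u * H (((n : ℝ) + 1) • u) := by
          have := Measure.integral_comp_smul (volume : Measure ℂ)
            (fun t => kernel 0 (((n : ℝ) + 1)⁻¹ • t) * H t) ((n : ℝ) + 1)
          rw [Complex.finrank_real_complex, abs_of_nonneg (by positivity), ← integral_smul] at this
          simp only [inv_smul_smul₀ hn] at this
          rw [this]
          refine integral_congr_ae (ae_of_all _ fun t => ?_)
          simp only [kernel_apply n, smul_mul_assoc]
  simp only [hS']
  have : Tendsto (fun n : ℕ => ∫ u, kernel 0 u * H (((n : ℝ) + 1) • u)) atTop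
      (𝓝 (∫ u, kernel 0 u * 0)) := by
    refine tendsto_integral_of_dominated_convergence
      (fun u => ‖kernel 0 u‖ * ∫ y, ‖f y‖ * C) (fun n => ?_) ?_ (fun n => ?_) ?_
    · exact ((kernel 0).continuous.mul
        (hHc.comp (continuous_const_smul _))).aestronglyMeasurable
    · exact (kernel 0).integrable.norm.mul_const _
    · refine ae_of_all _ fun u => ?_
      rw [norm_mul]
      exact mul_le_mul_of_nonneg_left (hHb _) (norm_nonneg _)
    -- For u ≠ 0 the points (n + 1)u leave every compact set; the single point u = 0 is negligible.
    · filter_upwards [Measure.ae_ne volume (0 : ℂ)] with u hu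
      refine Tendsto.const_mul _ (hH0.comp ?_)
      refine tendsto_cocompact_of_tendsto_dist_comp_atTop (0 : ℂ) ?_
      simp only [dist_zero_right, norm_smul]
      refine Tendsto.atTop_mul_const (norm_pos_iff.2 hu) ?_
      refine tendsto_norm_atTop_atTop.comp ?_
      exact tendsto_atTop_add_const_right _ _ tendsto_natCast_atTop_atTop
  simpa using this

end VanishesUnderAveraging

/-- A Schwartz function with compactly supported Fourier transform differs from its averages by an
element of the range of the free operator. -/
theorem exists_schwartzFreeOp_eq {f : 𝓢(ℂ, ℂ)} (hf : HasCompactSupport (𝓕 f : 𝓢(ℂ, ℂ))) (n : ℕ) :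
    ∃ h, schwartzFreeOp h = f - average n f := by
  set q : ℂ → ℂ := fun ξ =>
    (1 - schwartzCutoff n ξ) * ((freeSymbol ξ : ℝ) : ℂ)⁻¹ * (𝓕 f) ξ with hq
  have hqc : HasCompactSupport q := hf.mul_left
  have hqs : ContDiff ℝ ∞ q := by
    rw [contDiff_iff_contDiffAt]
    intro ξ
    -- The inverse symbol is singular only at the origin, and `1 - schwartzCutoff n` vanishes in a
    -- neighbourhood of it.
    by_cases hξ : ξ = 0
    · subst hξ
      have : q =ᶠ[𝓝 0] fun _ => 0 := by
        have h1 : Tendsto (fun ξ : ℂ => ((n : ℝ) + 1) • ξ) (𝓝 0) (𝓝 0) := by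
          simpa using (continuous_const_smul ((n : ℝ) + 1)).tendsto (0 : ℂ)
        filter_upwards [h1.eventually cutoff.eventuallyEq_one] with ξ hξ
        have hξ' : schwartzCutoff n ξ = 1 := by
          rw [schwartzCutoff_apply, hξ]
          simp
        simp only [hq, hξ', sub_self, zero_mul]
      exact contDiffAt_const.congr_of_eventuallyEq this
    · have hσ : ContDiffAt ℝ ∞ (fun ξ => ((freeSymbol ξ : ℝ) : ℂ)) ξ :=
        (Complex.ofRealCLM.contDiff.comp contDiff_freeSymbol).contDiffAt
      refine ContDiffAt.mul (ContDiffAt.mul ?_ (hσ.inv ?_)) ((𝓕 f).smooth ⊤).contDiffAt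
      · exact contDiffAt_const.sub ((schwartzCutoff n).smooth ⊤).contDiffAt
      · exact_mod_cast (freeSymbol_pos hξ).ne'
  refine ⟨𝓕⁻ (hqc.toSchwartzMap hqs), ?_⟩
  apply (FourierTransform.fourierCLE ℂ 𝓢(ℂ, ℂ)).injective
  rw [map_sub]
  ext ξ
  simp only [FourierTransform.fourierCLE_apply]
  rw [fourier_schwartzFreeOp, FourierTransform.fourier_fourierInv_eq, sub_apply, fourier_average,
    ← schwartzCutoff_apply]
  change (freeSymbol ξ : ℂ) * ((1 - schwartzCutoff n ξ) * ((freeSymbol ξ : ℝ) : ℂ)⁻¹ * (𝓕 f) ξ) = _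
  by_cases hξ : ξ = 0
  · have : schwartzCutoff n ξ = 1 := by
      rw [schwartzCutoff_apply, hξ, smul_zero, cutoff.eventuallyEq_one.eq_of_nhds]
      simp
    rw [this]
    ring
  · have : (freeSymbol ξ : ℂ) ≠ 0 := by exact_mod_cast (freeSymbol_pos hξ).ne'
    field_simp

/-- On band-limited `f`, `S f` equals `S (average n f)` for all `n` because the difference lies in
the range of L₀; letting n → ∞ gives zero. This stands in for the structure theorem on distributions
with spectrum at the origin. -/
theorem VanishesUnderAveraging.eq_zero {S : 𝓢(ℂ, ℂ) →L[ℂ] ℂ} (h : VanishesUnderAveraging S)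
    (h0 : ∀ f, S (schwartzFreeOp f) = 0) (f : 𝓢(ℂ, ℂ)) : S f = 0 := by
  have hd : Dense {f : 𝓢(ℂ, ℂ) | HasCompactSupport (𝓕 f : 𝓢(ℂ, ℂ))} :=
    SchwartzMap.dense_hasCompactSupport.preimage
      (FourierTransform.fourierCLE ℂ 𝓢(ℂ, ℂ)).toHomeomorph.isOpenMap
  have hS : (S : 𝓢(ℂ, ℂ) → ℂ) = fun _ => 0 := by
    refine S.continuous.ext_on hd continuous_const fun f hf => ?_
    have e : ∀ n, S (average n f) = S f := fun n => by
      obtain ⟨g, hg⟩ := exists_schwartzFreeOp_eq hf n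
      rw [← sub_eq_zero, ← neg_eq_zero, neg_sub, ← map_sub, ← hg, h0]
    have := h f
    simp only [e] at this
    exact tendsto_nhds_unique tendsto_const_nhds this
  rw [hS]

/-! ### Decaying solutions are annihilated by `annX`. -/

section Annihilation

theorem norm_T_le (z : ℂ) : ‖(T : ℂ → ℂ) z‖ ≤ 1 := by
  have h : (T : ℂ → ℂ) z = ((z.re ^ 2 + z.im ^ 2 + 3 : ℝ) : ℂ)⁻¹ := by
    rw [T_apply]
    push_cast
    rfl
  rw [h, norm_inv, Complex.norm_real, Real.norm_of_nonneg (by positivity)]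
  exact inv_le_one_of_one_le₀ (by nlinarith [sq_nonneg z.re, sq_nonneg z.im])

theorem norm_mul_T_le {a : ℝ} {z : ℂ} (ha : |a| ≤ z.re ^ 2 + z.im ^ 2 + 3) :
    ‖(a : ℂ) * (T : ℂ → ℂ) z‖ ≤ 1 := by
  have h : (T : ℂ → ℂ) z = ((z.re ^ 2 + z.im ^ 2 + 3 : ℝ) : ℂ)⁻¹ := by
    rw [T_apply]
    push_cast
    rfl
  have h0 : 0 < z.re ^ 2 + z.im ^ 2 + 3 := by positivity
  rw [h, norm_mul, norm_inv, Complex.norm_real, Complex.norm_real, Real.norm_of_nonneg h0.le,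
    ← div_eq_mul_inv, div_le_one h0]
  exact ha

theorem norm_X_mul_T_le (z : ℂ) : ‖((X * T : smoothFunctions) : ℂ → ℂ) z‖ ≤ 1 :=
  norm_mul_T_le (a := z.re) <| abs_le.2 ⟨by nlinarith [sq_nonneg (z.re + 1), sq_nonneg z.im],
    by nlinarith [sq_nonneg (z.re - 1), sq_nonneg z.im]⟩

theorem norm_Y_mul_T_le (z : ℂ) : ‖((Y * T : smoothFunctions) : ℂ → ℂ) z‖ ≤ 1 :=
  norm_mul_T_le (a := z.im) <| abs_le.2 ⟨by nlinarith [sq_nonneg (z.im + 1), sq_nonneg z.re],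
    by nlinarith [sq_nonneg (z.im - 1), sq_nonneg z.re]⟩

theorem norm_correction_le (z : ℂ) : ‖(correction : ℂ → ℂ) z‖ ≤ 24 + 48 + 144 := by
  have e : (correction : ℂ → ℂ) z = 24 * (T : ℂ → ℂ) z
      - 48 * ((X * T : smoothFunctions) : ℂ → ℂ) z ^ 2 - 144 * (T : ℂ → ℂ) z ^ 2 := by
    change 24 * (T : ℂ → ℂ) z - 48 * (X : ℂ → ℂ) z ^ 2 * (T : ℂ → ℂ) z ^ 2
      - 144 * (T : ℂ → ℂ) z ^ 2 = 24 * (T : ℂ → ℂ) z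
      - 48 * ((X : ℂ → ℂ) z * (T : ℂ → ℂ) z) ^ 2 - 144 * (T : ℂ → ℂ) z ^ 2
    ring
  have h1 := norm_T_le z
  have h2 : ‖((X * T : smoothFunctions) : ℂ → ℂ) z ^ 2‖ ≤ 1 := by
    rw [norm_pow]
    exact pow_le_one₀ (norm_nonneg _) (norm_X_mul_T_le z)
  have h3 : ‖(T : ℂ → ℂ) z ^ 2‖ ≤ 1 := by
    rw [norm_pow]
    exact pow_le_one₀ (norm_nonneg _) h1
  rw [e]
  refine (norm_sub_le _ _).trans (add_le_add ((norm_sub_le _ _).trans (add_le_add ?_ ?_)) ?_) <;>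
    rw [norm_mul, Complex.norm_ofNat] <;> linarith

variable {u : smoothFunctions} {S : 𝓢(ℂ, ℂ) →L[ℂ] ℂ}

theorem VanishesUnderAveraging.comp_schwartzMul
    (hu : Tendsto (u : ℂ → ℂ) (cocompact ℂ) (𝓝 0)) (hS : ∀ f, S f = ∫ z, f z * (u : ℂ → ℂ) z)
    {c : smoothFunctions} (hc : (c : ℂ → ℂ).HasTemperateGrowth) {C : ℝ}
    (hC : ∀ z, ‖(c : ℂ → ℂ) z‖ ≤ C) : VanishesUnderAveraging (S ∘L schwartzMul c) := by
  refine of_pairing (Ψ := fun z => (c : ℂ → ℂ) z * (u : ℂ → ℂ) z)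
    ((continuous_coe c).mul (continuous_coe u)) ?_ fun f => ?_
  · refine squeeze_zero_norm (a := fun z => C * ‖(u : ℂ → ℂ) z‖) (fun z => ?_) ?_
    · rw [norm_mul]
      exact mul_le_mul_of_nonneg_right (hC z) (norm_nonneg _)
    · simpa using (tendsto_zero_iff_norm_tendsto_zero.1 hu).const_mul C
  · rw [ContinuousLinearMap.comp_apply, hS]
    refine integral_congr_ae (ae_of_all _ fun z => ?_)
    have : schwartzMul c f z = (c : ℂ → ℂ) z * f z := SchwartzMap.smulLeftCLM_apply_apply hc f z
    simp only [this]
    ring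

/-- In each term the bounded coefficient multiplies u, preserving its decay, and the derivatives
stay on the test function, where they commute with averaging. -/
theorem vanishesUnderAveraging_comp_schwartzIntertwiner'
    (hu : Tendsto (u : ℂ → ℂ) (cocompact ℂ) (𝓝 0)) (hS : ∀ f, S f = ∫ z, f z * (u : ℂ → ℂ) z) :
    VanishesUnderAveraging (S ∘L schwartzIntertwiner') := by
  have h0 : VanishesUnderAveraging S := .of_pairing (continuous_coe u) hu hS
  have hT := VanishesUnderAveraging.comp_schwartzMul hu hS hasTemperateGrowth_T norm_T_le
  have hXT := VanishesUnderAveraging.comp_schwartzMul hu hS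
    (hasTemperateGrowth_mul hasTemperateGrowth_X hasTemperateGrowth_T) norm_X_mul_T_le
  have hYT := VanishesUnderAveraging.comp_schwartzMul hu hS
    (hasTemperateGrowth_mul hasTemperateGrowth_Y hasTemperateGrowth_T) norm_Y_mul_T_le
  have hcor := VanishesUnderAveraging.comp_schwartzMul hu hS hasTemperateGrowth_correction
    norm_correction_le
  have h2 := (h0.comp_schwartzDir 1).comp_schwartzDir 1
  have h4 := (h2.comp_schwartzDir 1).comp_schwartzDir 1
  have h := ((((((h4.smul 4).sub (h2.smul 3)).add
    (((hT.comp_schwartzDir 1).comp_schwartzDir 1).smul 36)).add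
    ((hXT.comp_schwartzDir 1).smul 12)).sub ((hYT.comp_schwartzDir Complex.I).smul 12)).sub
    ((((hXT.comp_schwartzDir 1).comp_schwartzDir 1).comp_schwartzDir 1).smul 24)).add hcor
  convert! h using 1
  ext f
  have e : schwartzIntertwiner' f = schwartzIntertwiner f + schwartzMul correction f := rfl
  simp only [ContinuousLinearMap.comp_apply, e, schwartzIntertwiner_apply, map_add, map_sub,
    map_smul, add_apply, sub_apply, smul_apply]

theorem annX_eq_zero (hu : Tendsto (u : ℂ → ℂ) (cocompact ℂ) (𝓝 0)) (h : linOp u = 0) :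
    annX u = 0 := by
  obtain ⟨C, hC⟩ : ∃ C, ∀ z, ‖(u : ℂ → ℂ) z‖ ≤ C := by
    let u₀ : ZeroAtInftyContinuousMap ℂ ℂ := ⟨⟨u, continuous_coe u⟩, hu⟩
    exact ⟨‖u₀.toBCF‖, fun z => u₀.toBCF.norm_coe_le_norm z⟩
  obtain ⟨S, hS⟩ := exists_pairing (continuous_coe u) hC
  -- Integration by parts is available for compactly supported test functions; continuity and
  -- density extend the identity to all Schwartz functions.
  have hS0 : (S ∘L schwartzLinOpAdj : 𝓢(ℂ, ℂ) → ℂ) = fun _ => 0 := by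
    refine (S ∘L schwartzLinOpAdj).continuous.ext_on SchwartzMap.dense_hasCompactSupport
      continuous_const fun f hf => ?_
    have := (isFormalAdjoint_linOp (ofSchwartz f) hf).2 u
    rw [h] at this
    rw [ContinuousLinearMap.comp_apply, hS]
    simp only [← ofSchwartz_apply, ofSchwartz_schwartzLinOpAdj]
    rw [this]
    simp
  -- The intertwining relation turns L u = 0 into the vanishing of S ∘ P' on the range of L₀.
  have hS1 : ∀ f, S (schwartzIntertwiner' f) = 0 :=
    (vanishesUnderAveraging_comp_schwartzIntertwiner' hu hS).eq_zero fun f => by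
      rw [ContinuousLinearMap.comp_apply, ← schwartzLinOpAdj_schwartzIntertwiner]
      exact congrFun hS0 (schwartzIntertwiner f)
  have hae : ∀ᵐ z ∂(volume : Measure ℂ), (annX u : ℂ → ℂ) z = 0 := by
    refine ae_eq_zero_of_integral_contDiff_smul_eq_zero
      (continuous_coe (annX u)).locallyIntegrable fun g hg hgc => ?_
    let G : smoothFunctions := ⟨fun z => (g z : ℂ), Complex.ofRealCLM.contDiff.comp hg⟩
    have hGc : HasCompactSupport (G : ℂ → ℂ) := hgc.comp_left (g := fun x : ℝ => (x : ℂ)) (by simp)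
    obtain ⟨k, hk⟩ := exists_ofSchwartz_eq hGc
    have h2 := (isFormalAdjoint_annX G hGc).2 u
    have h3 := hS1 k
    rw [hS] at h3
    simp only [← ofSchwartz_apply, ofSchwartz_schwartzIntertwiner', hk] at h3
    rw [h3] at h2
    simp only [Complex.real_smul]
    exact h2.symm
  have := (continuous_coe (annX u)).ae_eq_iff_eq volume continuous_const |>.1 hae
  exact Subtype.ext this

end Annihilation

/-! ### Passage between real functions on ℝ × ℝ and the algebra. -/

section Lift

/-- A smooth real function on the plane as a smooth function of a complex variable. -/
noncomputable def lift (ψ : ℝ × ℝ → ℝ) (hψ : ContDiff ℝ ∞ ψ) : smoothFunctions :=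
  ⟨fun z => (ψ (z.re, z.im) : ℂ), Complex.ofRealCLM.contDiff.comp
    (hψ.comp (Complex.reCLM.contDiff.prodMk Complex.imCLM.contDiff))⟩

theorem lift_apply {ψ : ℝ × ℝ → ℝ} (hψ : ContDiff ℝ ∞ ψ) (z : ℂ) :
    (lift ψ hψ : ℂ → ℂ) z = ψ (z.re, z.im) := rfl

theorem partialX_eq_fderiv {ψ : ℝ × ℝ → ℝ} (hψ : ContDiff ℝ ∞ ψ) (p : ℝ × ℝ) :
    partialX ψ p = fderiv ℝ ψ p (1, 0) := by
  have h1 : HasDerivAt (fun s : ℝ => (s, p.2)) ((1 : ℝ), (0 : ℝ)) p.1 :=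
    (hasDerivAt_id p.1).prodMk (hasDerivAt_const p.1 p.2)
  exact ((hψ.differentiable (by simp) p).hasFDerivAt.comp_hasDerivAt p.1 h1).deriv

theorem partialY_eq_fderiv {ψ : ℝ × ℝ → ℝ} (hψ : ContDiff ℝ ∞ ψ) (p : ℝ × ℝ) :
    partialY ψ p = fderiv ℝ ψ p (0, 1) := by
  have h1 : HasDerivAt (fun s : ℝ => (p.1, s)) ((0 : ℝ), (1 : ℝ)) p.2 :=
    (hasDerivAt_const p.2 p.1).prodMk (hasDerivAt_id p.2)
  exact ((hψ.differentiable (by simp) p).hasFDerivAt.comp_hasDerivAt p.2 h1).deriv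

theorem contDiff_partialX {ψ : ℝ × ℝ → ℝ} (hψ : ContDiff ℝ ∞ ψ) : ContDiff ℝ ∞ (partialX ψ) := by
  rw [funext (partialX_eq_fderiv hψ)]
  exact (hψ.fderiv_right (m := ∞) (by simp)).clm_apply contDiff_const

theorem contDiff_partialY {ψ : ℝ × ℝ → ℝ} (hψ : ContDiff ℝ ∞ ψ) : ContDiff ℝ ∞ (partialY ψ) := by
  rw [funext (partialY_eq_fderiv hψ)]
  exact (hψ.fderiv_right (m := ∞) (by simp)).clm_apply contDiff_const

theorem dir_lift (v : ℂ) {ψ : ℝ × ℝ → ℝ} (hψ : ContDiff ℝ ∞ ψ) (z : ℂ) :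
    (dir v (lift ψ hψ) : ℂ → ℂ) z = fderiv ℝ ψ (z.re, z.im) (v.re, v.im) := by
  have h1 : HasFDerivAt (fun z : ℂ => (z.re, z.im)) (Complex.reCLM.prod Complex.imCLM) z :=
    Complex.reCLM.hasFDerivAt.prodMk Complex.imCLM.hasFDerivAt
  have h2 := Complex.ofRealCLM.hasFDerivAt.comp z
    ((hψ.differentiable (by simp) (z.re, z.im)).hasFDerivAt.comp z h1)
  rw [dir_apply]
  exact congrArg (fun L : ℂ →L[ℝ] ℂ => L v) h2.fderiv

theorem dx_lift {ψ : ℝ × ℝ → ℝ} (hψ : ContDiff ℝ ∞ ψ) :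
    dx (lift ψ hψ) = lift (partialX ψ) (contDiff_partialX hψ) := by
  ext z
  rw [lift_apply, partialX_eq_fderiv hψ]
  exact dir_lift 1 hψ z

theorem dy_lift {ψ : ℝ × ℝ → ℝ} (hψ : ContDiff ℝ ∞ ψ) :
    dy (lift ψ hψ) = lift (partialY ψ) (contDiff_partialY hψ) := by
  ext z
  rw [lift_apply, partialY_eq_fderiv hψ]
  exact dir_lift Complex.I hψ z

theorem contDiff_lump : ContDiff ℝ ∞ lump := by
  unfold lump
  refine ContDiff.div (by fun_prop) (by fun_prop) fun p => ?_
  positivity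

theorem lift_lump : lift lump contDiff_lump = lumpFun := by
  ext z
  change ((lump (z.re, z.im) : ℝ) : ℂ) = 4 * ((z.im : ℂ) ^ 2 - (z.re : ℂ) ^ 2 + 3) *
    (((z.re : ℂ) ^ 2 + (z.im : ℂ) ^ 2 + 3)⁻¹) ^ 2
  rw [lump]
  push_cast
  rw [inv_pow, div_eq_mul_inv]

theorem linOp_lift {ψ : ℝ × ℝ → ℝ} (hψ : ContDiff ℝ ∞ ψ) (z : ℂ) :
    (linOp (lift ψ hψ) : ℂ → ℂ) z = linearizedKPI ψ (z.re, z.im) := by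
  have hψ₂ := contDiff_partialX (contDiff_partialX hψ)
  have hw : ContDiff ℝ ∞ fun q => partialX (partialX ψ) q - ψ q + 6 * lump q * ψ q :=
    (hψ₂.sub hψ).add ((contDiff_const.mul contDiff_lump).mul hψ)
  have e : dx (dx (lift ψ hψ)) - lift ψ hψ + 6 * lumpFun * lift ψ hψ = lift _ hw := by
    rw [dx_lift, dx_lift, ← lift_lump]
    ext z
    simp only [lift_apply]
    push_cast
    rfl
  rw [linOp, e, dx_lift, dx_lift, dy_lift, dy_lift, sub_coe, lift_apply, lift_apply, linearizedKPI]
  push_cast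
  rfl

theorem tendsto_lift {ψ : ℝ × ℝ → ℝ} (hψ : ContDiff ℝ ∞ ψ)
    (h : Tendsto ψ (comap (fun p : ℝ × ℝ => p.1 ^ 2 + p.2 ^ 2) atTop) (𝓝 0)) :
    Tendsto (lift ψ hψ : ℂ → ℂ) (cocompact ℂ) (𝓝 0) := by
  have h1 : Tendsto (fun z : ℂ => (z.re, z.im)) (cocompact ℂ)
      (comap (fun p : ℝ × ℝ => p.1 ^ 2 + p.2 ^ 2) atTop) := by
    rw [tendsto_comap_iff]
    have : ((fun p : ℝ × ℝ => p.1 ^ 2 + p.2 ^ 2) ∘ fun z : ℂ => (z.re, z.im)) =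
        fun z : ℂ => ‖z‖ ^ 2 := by
      ext z
      simp only [Function.comp_apply, Complex.sq_norm, Complex.normSq_apply]
      ring
    rw [this]
    exact (tendsto_pow_atTop two_ne_zero).comp tendsto_norm_cocompact_atTop
  have h2 := (Complex.continuous_ofReal.tendsto 0).comp (h.comp h1)
  simpa using! h2

end Lift

/-- Decaying solutions of the linearized equation are spanned by the derivatives of the lump. -/
theorem exists_eq_partialX_add_partialY (φ : ℝ × ℝ → ℝ) (hsmooth : ContDiff ℝ ∞ φ)
    (hsol : ∀ p : ℝ × ℝ, linearizedKPI φ p = 0)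
    (hdecay : Tendsto φ (comap (fun p : ℝ × ℝ => p.1 ^ 2 + p.2 ^ 2) atTop) (𝓝 0)) :
    ∃ c₁ c₂ : ℝ, ∀ p : ℝ × ℝ, φ p = c₁ * partialX lump p + c₂ * partialY lump p := by
  have hlin : linOp (lift φ hsmooth) = 0 := by
    ext z
    rw [linOp_lift, hsol, Complex.ofReal_zero]
    rfl
  have hlim := tendsto_lift hsmooth hdecay
  have hX := annX_eq_zero hlim hlin
  have hY : annY (lift φ hsmooth) = 0 := by
    rw [← annX_sub_linOp, hX, hlin, mul_zero, sub_zero]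
  obtain ⟨c₁, c₂, hc⟩ := eq_combination_of_tendsto_zero hX hY hlim
  -- The coefficients found are complex; since φ and the lump are real, their real parts serve.
  refine ⟨c₁.re, c₂.re, fun p => ?_⟩
  rw [← lift_lump, dx_lift, dy_lift] at hc
  have h := congrArg (fun f : smoothFunctions => ((f : ℂ → ℂ) ⟨p.1, p.2⟩).re) hc
  simpa [lift_apply, add_coe, smul_coe] using h

end smoothFunctions

theorem theorem1 (φ : ℝ × ℝ → ℝ) (hsmooth : ContDiff ℝ ∞ φ)
    (hsol : ∀ p : ℝ × ℝ, linearizedKPI φ p = 0)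
    (hdecay : Tendsto φ (comap (fun p : ℝ × ℝ => p.1 ^ 2 + p.2 ^ 2) atTop) (𝓝 0)) :
    ∃ c₁ c₂ : ℝ, ∀ p : ℝ × ℝ, φ p = c₁ * partialX lump p + c₂ * partialY lump p :=
  smoothFunctions.exists_eq_partialX_add_partialY φ hsmooth hsol hdecay
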